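/- Fix a function $\epsilon:[0,\infty)\to[0,1]$. A real function $\varphi\in L^2(\mathbb{R}^d)$ is called (the square root of an) $\epsilon(r)$ Fourier-concentrated function $\varphi^2$ if $\|\hat\varphi\cdot\mathbf 1_{\{\|\xi\|\ge s\}}\|_{L^2}\le\epsilon(s)\,\|\hat\varphi\|_{L^2}$ for all $s\ge0$, where $\hat\varphi(\xi)=\int e^{-2\pi i\langle x,\xi\rangle}\varphi(x)\,dx$ (extended to $L^2$). There are universal constants $c_1,c_2,c_3>0$ such that the following holds for all $d\ge c_1$ and $r\ge 0$. Suppose that - $\psi:\mathbb{R}\to[-1,1]$ is periodic with period $1$ and has bounded variation on every finite interval; - $\varphi^2=\sum_i\alpha_i\varphi_i^2$ is a finite or countable mixture ($\alpha_i\ge0$, $\sum_i\alpha_i=1$) of densities $\varphi_i^2$ on $\mathbb{R}^d$, each of them $\epsilon(r)$ Fourier-concentrated; - $\mathcal W$ is a subset of a Euclidean space $\mathbb{R}^k$, and $f:\mathbb{R}^k\times\mathbb{R}^d\to\mathbb{R}$ is such that for each $w\in\mathcal W$: $f(v,\cdot)\in L^2(\varphi^2)$ for all $v$ near $w$; $f(\cdot,x)$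 is differentiable at $w$ for $\varphi^2$-almost every $x$; there is a finite $K$ (which may depend on $w$) with $\mathbb{E}_{x\sim\varphi^2}|f(v,x)-f(w,x)|^2\le K^2\|v-w\|^2$ for all $v$ near $w$; and $\mathbb{E}_{x\sim\varphi^2}\left\|\frac{\partial}{\partial w}f(w,x)\right\|^2\le G_w<\infty$. For $w^\star\in\mathbb{R}^d$ let $F_{w^\star}(w)=\mathbb{E}_{x\sim\varphi^2}\left[(f(w,x)-\psi(\langle w^\star,x\rangle))^2\right]$, let $w^\star$ be chosen uniformly at random from the sphere $\{\|w^\star\|=2r\}$, and let $$\varepsilon=\sqrt[3]{c_2\Big(\sup_{w\in\mathcal W}G_w\Big)\Big(\exp(-c_3d)+\sum_{n=1}^\infty\epsilon(nr)\Big)}\in[0,\infty].$$ Then each $F_{w^\star}$ with $\|w^\star\|=2r$ is differentiable at every point of $\mathcal W$, and there is an $\varepsilon$-approximate gradient oracle, that is, a function $(w^\star,w)\mapsto g_{w^\star}(w)\in\mathbb{R}^k$ with $\|g_{w^\star}(w)-\nabla F_{w^\star}(w)\|\le\varepsilon$ for all $w\in\mathcal W$ and all $w^\star$ with $\|w^\star\|=2r$,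 such that the following holds for every $p\in(0,1)$ and every (possibly randomized) iterative algorithm, which at every iteration chooses a point of $\mathcal W$ depending only on its random bits and on the previous oracle responses, receives the oracle's response at that point, and whose output depends only on its random bits and on the responses received. For every realization of the random bits there is an event $S$, of probability at least $1-p$ over the choice of $w^\star$, such that for every number of iterations $T\le p/\varepsilon$ (with $p/0=\infty$, $p/\infty=0$) the output of the algorithm after $T$ iterations with the oracle $g_{w^\star}$ is the same for all $w^\star\in S$. -/

import Mathlib

open MeasureTheory Filter Topology Set
open scoped ENNReal NNReal FourierTransform RealInnerProductSpace

noncomputable section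

/-- `φ` is a square root of an `ε`-Fourier-concentrated function: `φ ∈ L²(ℝᵈ)` and
`‖φ̂ · 1_{‖ξ‖ ≥ s}‖ ≤ ε(s) ‖φ̂‖` for all `s ≥ 0`, where `φ̂ ∈ L²` is the Fourier transform
(with the kernel `exp (-2πi⟨x, ξ⟩)`). -/
def IsFourierConcentrated {d : ℕ} (ε : ℝ → ℝ) (φ : EuclideanSpace ℝ (Fin d) → ℝ) : Prop :=
  ∃ hφ : MemLp (fun x => (φ x : ℂ)) 2 (volume : Measure (EuclideanSpace ℝ (Fin d))),
    ∀ s : ℝ, 0 ≤ s →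
      eLpNorm ({ξ : EuclideanSpace ℝ (Fin d) | s ≤ ‖ξ‖}.indicator
          ((𝓕 (hφ.toLp _) : Lp ℂ 2 (volume : Measure (EuclideanSpace ℝ (Fin d)))) :
            EuclideanSpace ℝ (Fin d) → ℂ)) 2 volume
        ≤ ENNReal.ofReal (ε s) *
          eLpNorm ((𝓕 (hφ.toLp _) : Lp ℂ 2 (volume : Measure (EuclideanSpace ℝ (Fin d)))) :
            EuclideanSpace ℝ (Fin d) → ℂ) 2 volume

/-- The measure on `ℝᵈ` with density `∑ᵢ αᵢ φᵢ²`. -/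
def mixtureMeasure {d : ℕ} {ι : Type} (α : ι → ℝ) (φ : ι → EuclideanSpace ℝ (Fin d) → ℝ) :
    Measure (EuclideanSpace ℝ (Fin d)) :=
  volume.withDensity (fun x => ∑' i, ENNReal.ofReal (α i * φ i x ^ 2))

/-- The uniform probability distribution on the sphere of radius `R` about `0` in `ℝᵈ`
(`d ≥ 1`): the normalised surface measure of the unit sphere, scaled by `R`. -/
def sphereUniform (d : ℕ) (R : ℝ) : Measure (EuclideanSpace ℝ (Fin d)) :=
  Measure.map
    (fun u : Metric.sphere (0 : EuclideanSpace ℝ (Fin d)) 1 => R • (u : EuclideanSpace ℝ (Fin d)))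
    (((volume : Measure (EuclideanSpace ℝ (Fin d))).toSphere univ)⁻¹ •
      (volume : Measure (EuclideanSpace ℝ (Fin d))).toSphere)

/-- The objective `F_{w⋆}(w) = 𝔼_{x ∼ μ} (f(w, x) - ψ(⟨w⋆, x⟩))²`. -/
def objective {d k : ℕ} (μ : Measure (EuclideanSpace ℝ (Fin d))) (ψ : ℝ → ℝ)
    (f : EuclideanSpace ℝ (Fin k) → EuclideanSpace ℝ (Fin d) → ℝ)
    (wstar : EuclideanSpace ℝ (Fin d)) (w : EuclideanSpace ℝ (Fin k)) : ℝ :=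
  ∫ x, (f w x - ψ ⟪wstar, x⟫) ^ 2 ∂μ

/-- A (possibly randomized) iterative algorithm over the domain `W`: `Ω` is the space of
realizations of its random bits. From the bits and the list of oracle responses received so
far, it chooses the next query point in `W`, and the output it would return now. -/
structure IterativeAlgorithm {k : ℕ} (W : Set (EuclideanSpace ℝ (Fin k))) (Ω Out : Type) where
  /-- the next point at which the oracle is queried -/
  query : Ω → List (EuclideanSpace ℝ (Fin k)) → W
  /-- the output returned if the algorithm stops now -/
  output : Ω → List (EuclideanSpace ℝ (Fin k)) → Out

/-- The oracle responses received in the first `t` iterations, when a query `w` is answered by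
`oracle w` and the random bits are `ω`. -/
def IterativeAlgorithm.responses {k : ℕ} {W : Set (EuclideanSpace ℝ (Fin k))} {Ω Out : Type}
    (A : IterativeAlgorithm W Ω Out)
    (oracle : EuclideanSpace ℝ (Fin k) → EuclideanSpace ℝ (Fin k)) (ω : Ω) :
    ℕ → List (EuclideanSpace ℝ (Fin k))
  | 0 => []
  | t + 1 => A.responses oracle ω t ++ [oracle (A.query ω (A.responses oracle ω t))]

/-- The output after `t` iterations. -/
def IterativeAlgorithm.outputAfter {k : ℕ} {W : Set (EuclideanSpace ℝ (Fin k))} {Ω Out : Type}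
    (A : IterativeAlgorithm W Ω Out)
    (oracle : EuclideanSpace ℝ (Fin k) → EuclideanSpace ℝ (Fin k)) (ω : Ω) (t : ℕ) : Out :=
  A.output ω (A.responses oracle ω t)

/-- The accuracy `(c₂ · (sup_{w ∈ W} G_w) · (exp(-c₃ d) + ∑_{n ≥ 1} ε(n r)))^{1/3}`, in `[0, ∞]`. -/
def accuracy {k : ℕ} (c₂ c₃ : ℝ) (d : ℕ) (r : ℝ) (ε : ℝ → ℝ)
    (W : Set (EuclideanSpace ℝ (Fin k))) (G : EuclideanSpace ℝ (Fin k) → ℝ≥0) : ℝ≥0∞ :=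
  (ENNReal.ofReal c₂ * (⨆ w ∈ W, (G w : ℝ≥0∞)) *
    (ENNReal.ofReal (Real.exp (-c₃ * d)) +
      ∑' n : ℕ, ENNReal.ofReal (ε (((n : ℝ) + 1) * r)))) ^ (1 / 3 : ℝ)

end

/-!
Write `g` for the gradient of `f(·, x)` at a query point `w`, and `a₀` for the mean of `ψ` over a
period. The gradient of the objective at `w` is `2 𝔼[(f - ψ(⟨w⋆, ·⟩)) g]`
(`hasGradientAt_integral_sub_sq`), and it differs from `2 𝔼[(f - a₀) g]`, which does not depend on
`w⋆`, by twice the `correlation` `𝔼[(ψ(⟨w⋆, ·⟩) - a₀) g]`. The heart of the proof is that the second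
moment of this correlation over the random `w⋆` is at most
`64 𝔼‖g‖² (exp(-c₃ d) + ∑ ε(n r))` (`lintegral_enorm_correlation_sq_le`).

By Jensen's inequality and by working in coordinates, this reduces to one density `φ²` and a scalar
`g`. There the correlation is the inner product in `L²` of `h = φ g` with `φ (ψ(⟨w⋆, ·⟩) - a₀)`. The
Fourier transform of the latter is a sum of translates of the transform of `φ` by the nonzero
multiples `z w⋆`, weighted by the Fourier coefficients of `ψ`. As `‖w⋆‖ = 2 r`, a frequency outside
the double cone of half-angle `π / 6` about `w⋆` is at distance at least `|z| r` from `z w⋆`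
(`abs_mul_le_norm_sub_of_notMem_doubleCone`), so that off the cone the `z`-th translate has mass at
most `ε(|z| r)`. On the cone, the inner product is bounded by the mass of the transform of `h` there,
and a fixed frequency lies in the random cone with exponentially small probability
(`sphereUniform_doubleCone_le`). To avoid questions of convergence of the Fourier series of `ψ`, the
estimate is made for bounded trigonometric polynomials that converge to `ψ` almost everywhere
(`exists_trigPoly_tendsto`).

The oracle answers `2 𝔼[(f - a₀) g]` whenever this is accurate enough, and the true gradient
otherwise. For given random bits, the queries made against the first kind of answer form a fixed
sequence; by Chebyshev's inequality and a union bound, with probability at least `1 - p` over `w⋆`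
all the answers within the allowed number of iterations are of the first kind.
-/

/-! ### Modulation and the Fourier transform on `L²` -/

section FourierModulation

variable {V : Type*} [NormedAddCommGroup V] [InnerProductSpace ℝ V] [FiniteDimensional ℝ V]
  [MeasurableSpace V] [BorelSpace V]

open scoped SchwartzMap

/-- A Schwartz function times a character is again Schwartz, and its Fourier transform is a
translate. It is built as the inverse transform of the translate, so that no estimates on the
derivatives of the product are needed. -/
theorem SchwartzMap.exists_modulate (v : V) (f : 𝓢(V, ℂ)) :
    ∃ g : 𝓢(V, ℂ), (∀ x, g x = Real.fourierChar ⟪v, x⟫ • f x) ∧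
      ∀ ξ, (𝓕 g) ξ = (𝓕 f) (ξ - v) := by
  refine ⟨𝓕⁻ (SchwartzMap.compSubConstCLM ℂ v (𝓕 f)), fun x => ?_, fun ξ => ?_⟩
  · rw [SchwartzMap.fourierInv_coe, Real.fourierInv_eq]
    simp only [SchwartzMap.compSubConstCLM_apply]
    rw [← integral_add_right_eq_self _ v]
    simp only [add_sub_cancel_right, inner_add_left, AddChar.map_add_eq_mul,
      mul_comm _ (Real.fourierChar ⟪v, x⟫), mul_smul]
    refine (integral_smul (μ := volume) ((Real.fourierChar ⟪v, x⟫ : Circle) : ℂ)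
      (fun y => Real.fourierChar ⟪y, x⟫ • (𝓕 f) y)).trans ?_
    rw [← Real.fourierInv_eq, ← SchwartzMap.fourierInv_coe, FourierTransform.fourierInv_fourier_eq]
    rfl
  · simp

theorem memLp_modulate (v : V) (f : Lp ℂ 2 (volume : Measure V)) :
    MemLp (fun x => Real.fourierChar ⟪v, x⟫ • f x) 2 volume := by
  refine (Lp.memLp f).of_le (AEStronglyMeasurable.smul ?_ (Lp.aestronglyMeasurable f)) ?_
  · exact Continuous.aestronglyMeasurable (by fun_prop)
  · exact .of_forall fun x => by simp

/-- Multiplication by the character `x ↦ exp (2πi⟨v, x⟩)` on `L²`. -/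
noncomputable def modulation (v : V) :
    Lp ℂ 2 (volume : Measure V) →ₗᵢ[ℂ] Lp ℂ 2 (volume : Measure V) where
  toFun f := (memLp_modulate v f).toLp
  map_add' f g := by
    rw [← MemLp.toLp_add]
    apply MemLp.toLp_congr
    filter_upwards [Lp.coeFn_add f g] with x hx
    rw [hx, Pi.add_apply, Pi.add_apply, smul_add]
  map_smul' c f := by
    rw [RingHom.id_apply, ← MemLp.toLp_const_smul]
    apply MemLp.toLp_congr
    filter_upwards [Lp.coeFn_smul c f] with x hx
    rw [hx, Pi.smul_apply, Pi.smul_apply, smul_comm]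
  norm_map' f := by
    change ‖(memLp_modulate v f).toLp‖ = ‖f‖
    rw [Lp.norm_toLp, Lp.norm_def]
    congr 1
    exact eLpNorm_congr_norm_ae (.of_forall fun x => by simp)

theorem coeFn_modulation (v : V) (f : Lp ℂ 2 (volume : Measure V)) :
    modulation v f =ᵐ[volume] fun x => Real.fourierChar ⟪v, x⟫ • f x :=
  (memLp_modulate v f).coeFn_toLp

/-- On `L²`, the Fourier transform turns modulation into translation: both sides are continuous and
agree on the dense subspace of Schwartz functions. -/
theorem fourier_modulation (v : V) (f : Lp ℂ 2 (volume : Measure V)) :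
    (𝓕 (modulation v f) : Lp ℂ 2 (volume : Measure V)) =ᵐ[volume] fun ξ =>
      (𝓕 f : Lp ℂ 2 (volume : Measure V)) (ξ - v) := by
  have key : 𝓕 (modulation v f) = Lp.compMeasurePreserving (fun ξ : V => ξ - v)
      (measurePreserving_sub_right volume v) (𝓕 f : Lp ℂ 2 (volume : Measure V)) := by
    refine congrFun ((SchwartzMap.denseRange_toLpCLM (p := 2) (F := ℂ) (E := V) (μ := volume)
      ENNReal.ofNat_ne_top).equalizer (g := fun f => 𝓕 (modulation v f))
      (h := fun f => Lp.compMeasurePreserving (fun ξ : V => ξ - v)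
      (measurePreserving_sub_right volume v) (𝓕 f : Lp ℂ 2 (volume : Measure V))) ?_ ?_ ?_) f
    · exact (Lp.fourierTransformₗᵢ V ℂ).continuous.comp (modulation v).continuous
    · exact (Lp.isometry_compMeasurePreserving _).continuous.comp
        (Lp.fourierTransformₗᵢ V ℂ).continuous
    · funext u
      obtain ⟨g, hg, hg'⟩ := SchwartzMap.exists_modulate v u
      have h1 : modulation v (u.toLp 2) = g.toLp 2 := by
        refine Lp.ext ?_
        filter_upwards [coeFn_modulation v (u.toLp 2), u.coeFn_toLp 2 volume, g.coeFn_toLp 2 volume]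
          with x h1 h2 h3
        rw [h1, h2, h3, hg]
      simp only [Function.comp_apply, SchwartzMap.toLpCLM_apply]
      rw [h1, SchwartzMap.toLp_fourier_eq, SchwartzMap.toLp_fourier_eq]
      refine Lp.ext ?_
      filter_upwards [(𝓕 g).coeFn_toLp 2 volume, Lp.coeFn_compMeasurePreserving
        ((𝓕 u).toLp 2) (measurePreserving_sub_right volume v),
        (measurePreserving_sub_right volume v).quasiMeasurePreserving.ae
          ((𝓕 u).coeFn_toLp 2 volume)] with x h1 h2 h3
      rw [h1, h2, hg', Function.comp_apply, h3]
  rw [key]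
  exact Lp.coeFn_compMeasurePreserving _ _

theorem enorm_inner_le_of_split (C : Set V) (hC : MeasurableSet C)
    (H M : Lp ℂ 2 (volume : Measure V)) :
    ‖inner ℂ H M‖ₑ ≤ eLpNorm (C.indicator H) 2 volume * ‖M‖ₑ +
      ‖H‖ₑ * eLpNorm (Cᶜ.indicator M) 2 volume := by
  have hsplit : H = ((Lp.memLp H).indicator hC).toLp + ((Lp.memLp H).indicator hC.compl).toLp := by
    refine Lp.ext ?_
    filter_upwards [((Lp.memLp H).indicator hC).coeFn_toLp,
      ((Lp.memLp H).indicator hC.compl).coeFn_toLp, Lp.coeFn_add ((Lp.memLp H).indicator hC).toLp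
        ((Lp.memLp H).indicator hC.compl).toLp] with x h1 h2 h3
    rw [h3, Pi.add_apply, h1, h2]
    exact (congrFun (indicator_self_add_compl C H) x).symm
  have h2 : inner ℂ ((Lp.memLp H).indicator hC.compl).toLp M =
      inner ℂ H ((Lp.memLp M).indicator hC.compl).toLp := by
    rw [L2.inner_def, L2.inner_def]
    refine integral_congr_ae ?_
    filter_upwards [((Lp.memLp H).indicator hC.compl).coeFn_toLp,
      ((Lp.memLp M).indicator hC.compl).coeFn_toLp] with x h1 h2
    rw [h1, h2]
    by_cases hx : x ∈ Cᶜ <;> simp [hx]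
  have hb (A B : Lp ℂ 2 (volume : Measure V)) : ‖inner ℂ A B‖ₑ ≤ ‖A‖ₑ * ‖B‖ₑ := by
    rw [← enorm_norm A, ← enorm_norm B, ← enorm_mul]
    refine enorm_le_iff_norm_le.2 ?_
    simpa using norm_inner_le_norm A B
  nth_rw 1 [hsplit]
  rw [inner_add_left]
  refine (enorm_add_le _ _).trans (add_le_add ?_ ?_)
  · simpa [Lp.enorm_toLp] using hb ((Lp.memLp H).indicator hC).toLp M
  · rw [h2]
    simpa [Lp.enorm_toLp] using hb H ((Lp.memLp M).indicator hC.compl).toLp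

/-- Let `C` be a set of frequencies outside of which every `z • w`, `z ∈ s`, has distance at least
`|z| r`. The correlation of `H` with `F` times a trigonometric polynomial in `⟨w, ·⟩` is controlled
by the mass of the transform of `H` on `C` and by the mass of the transform of `F` far from `0`. -/
theorem enorm_inner_trigPoly_le (F H : Lp ℂ 2 (volume : Measure V)) (w : V) (r : ℝ)
    (s : Finset ℤ) (c : ℤ → ℂ) (B : ℝ≥0)
    (hB : ∀ x : V, ‖∑ z ∈ s, Real.fourierChar ((z : ℝ) * ⟪w, x⟫) • c z‖ₑ ≤ B)
    (C : Set V) (hC : MeasurableSet C)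
    (hCr : ∀ z ∈ s, ∀ ξ ∉ C, |(z : ℝ)| * r ≤ ‖ξ - (z : ℝ) • w‖) :
    ‖inner ℂ H (∑ z ∈ s, c z • modulation ((z : ℝ) • w) F)‖ₑ ≤
      B * ‖F‖ₑ * eLpNorm (C.indicator (𝓕 H : Lp ℂ 2 (volume : Measure V))) 2 volume +
      ‖H‖ₑ * ∑ z ∈ s, ‖c z‖ₑ * eLpNorm ({ξ : V | |(z : ℝ)| * r ≤ ‖ξ‖}.indicator
        (𝓕 F : Lp ℂ 2 (volume : Measure V))) 2 volume := by
  set M := ∑ z ∈ s, c z • modulation ((z : ℝ) • w) F with hM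
  have hMF : 𝓕 M = ∑ z ∈ s, c z • 𝓕 (modulation ((z : ℝ) • w) F) := by
    change Lp.fourierTransformₗᵢ V ℂ M = _
    rw [hM, map_sum]
    refine Finset.sum_congr rfl fun z _ => ?_
    rw [map_smul]; rfl
  have hMn : ‖M‖ₑ ≤ B * ‖F‖ₑ := by
    rw [Lp.enorm_def, Lp.enorm_def]
    refine eLpNorm_le_nnreal_smul_eLpNorm_of_ae_le_mul' ?_ 2
    have h1 : ∀ᵐ x : V, ∀ z ∈ s, modulation ((z : ℝ) • w) F x =
        Real.fourierChar ⟪(z : ℝ) • w, x⟫ • F x :=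
      (ae_ball_iff s.countable_toSet).2 fun z _ => coeFn_modulation _ F
    have h2 : ∀ᵐ x : V, ∀ z ∈ s, (c z • modulation ((z : ℝ) • w) F : Lp ℂ 2 (volume : Measure V)) x
        = c z * modulation ((z : ℝ) • w) F x :=
      (ae_ball_iff s.countable_toSet).2 fun z _ => Lp.coeFn_smul _ _
    filter_upwards [h1, h2, Lp.coeFn_finsetSum s (fun z => c z • modulation ((z : ℝ) • w) F)]
      with x h1 h2 h3
    rw [h3, Finset.sum_apply, Finset.sum_congr rfl fun z hz => h2 z hz,
      Finset.sum_congr rfl fun z hz => by rw [h1 z hz, mul_smul_comm, ← smul_mul_assoc],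
      ← Finset.sum_mul, enorm_mul]
    gcongr
    simpa [inner_smul_left] using hB x
  have hinner : inner ℂ H M = inner ℂ (𝓕 H) (𝓕 M) := (Lp.inner_fourier_eq H M).symm
  have hFM : ‖𝓕 M‖ₑ = ‖M‖ₑ := by
    rw [← enorm_norm, Lp.norm_fourier_eq, enorm_norm]
  have hFH : ‖𝓕 H‖ₑ = ‖H‖ₑ := by
    rw [← enorm_norm, Lp.norm_fourier_eq, enorm_norm]
  rw [hinner]
  refine (enorm_inner_le_of_split C hC (𝓕 H) (𝓕 M)).trans ?_
  rw [hFM, hFH, mul_comm _ ‖M‖ₑ]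
  gcongr
  rw [hMF]
  have h2 : ∀ᵐ x : V, ∀ z ∈ s, (c z • 𝓕 (modulation ((z : ℝ) • w) F) :
        Lp ℂ 2 (volume : Measure V)) x
        = c z * (𝓕 F : Lp ℂ 2 (volume : Measure V)) (x - (z : ℝ) • w) := by
    refine (ae_ball_iff s.countable_toSet).2 fun z _ => ?_
    filter_upwards [Lp.coeFn_smul (c z) (𝓕 (modulation ((z : ℝ) • w) F)),
      fourier_modulation ((z : ℝ) • w) F] with x h1 h2
    rw [h1, Pi.smul_apply, h2, smul_eq_mul]
  have hmeas₀ (z : ℤ) : AEStronglyMeasurable ({ξ : V | |(z : ℝ)| * r ≤ ‖ξ‖}.indicator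
      (𝓕 F : Lp ℂ 2 (volume : Measure V))) volume :=
    (Lp.aestronglyMeasurable _).indicator (measurableSet_le (by fun_prop) (by fun_prop))
  have hmeas (z : ℤ) : AEStronglyMeasurable (fun ξ => {ξ : V | |(z : ℝ)| * r ≤ ‖ξ‖}.indicator
      (𝓕 F : Lp ℂ 2 (volume : Measure V)) (ξ - (z : ℝ) • w)) volume :=
    (hmeas₀ z).comp_quasiMeasurePreserving
      (measurePreserving_sub_right volume ((z : ℝ) • w)).quasiMeasurePreserving
  have hs2 : ∀ z ∈ s, eLpNorm (fun ξ => c z * {ξ : V | |(z : ℝ)| * r ≤ ‖ξ‖}.indicator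
      (𝓕 F : Lp ℂ 2 (volume : Measure V)) (ξ - (z : ℝ) • w)) 2 volume =
      ‖c z‖ₑ * eLpNorm ({ξ : V | |(z : ℝ)| * r ≤ ‖ξ‖}.indicator
        (𝓕 F : Lp ℂ 2 (volume : Measure V))) 2 volume := fun z _ => by
    have h := eLpNorm_comp_measurePreserving (p := 2) (hmeas₀ z)
      (measurePreserving_sub_right volume ((z : ℝ) • w))
    rw [← h]
    exact eLpNorm_const_smul (c z) _ 2 volume
  rw [← Finset.sum_congr rfl hs2]
  refine le_trans ?_ (eLpNorm_sum_le (fun z _ => (hmeas z).const_mul (c z)) (by norm_num))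
  refine eLpNorm_mono_ae ?_
  filter_upwards [h2, Lp.coeFn_finsetSum s (fun z => c z • 𝓕 (modulation ((z : ℝ) • w) F))]
    with x h2 h3
  by_cases hx : x ∈ C
  · simp [hx]
  · rw [indicator_of_mem (show x ∈ Cᶜ from hx), h3, Finset.sum_apply, Finset.sum_apply]
    refine le_of_eq (congrArg _ (Finset.sum_congr rfl fun z hz => ?_))
    rw [h2 z hz, indicator_of_mem (show x - (z : ℝ) • w ∈ {ξ : V | |(z : ℝ)| * r ≤ ‖ξ‖} from
      hCr z hz x hx)]

end FourierModulation

/-! ### Double cones and the uniform distribution on the sphere -/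

section Sphere

open scoped Pointwise

theorem isProbabilityMeasure_sphereUniform {d : ℕ} (hd : 0 < d) (R : ℝ) :
    IsProbabilityMeasure (sphereUniform d R) := by
  have : Nontrivial (EuclideanSpace ℝ (Fin d)) :=
    Module.nontrivial_of_finrank_pos (R := ℝ) (by simpa using hd)
  constructor
  rw [sphereUniform, Measure.map_apply (by fun_prop) MeasurableSet.univ, preimage_univ,
    Measure.smul_apply, smul_eq_mul, ENNReal.inv_mul_cancel]
  · simp [-Measure.toSphere_apply_univ]
  · exact measure_ne_top _ _

theorem ae_norm_eq_sphereUniform (d : ℕ) {R : ℝ} (hR : 0 ≤ R) :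
    ∀ᵐ w ∂sphereUniform d R, ‖w‖ = R := by
  rw [sphereUniform, ae_map_iff (by fun_prop) (measurableSet_eq_fun (by fun_prop) (by fun_prop))]
  exact .of_forall fun u => by simp [norm_smul, abs_of_nonneg hR]

/-- The part of the unit ball within angle `π / 6` of the unit vector `e` lies in the ball of
radius `1 / √3` about `e / √3`. -/
theorem smul_mem_closedBall_of_le_inner {V : Type*} [NormedAddCommGroup V] [InnerProductSpace ℝ V]
    {e u : V} (he : ‖e‖ = 1) (hu : ‖u‖ = 1) {t : ℝ} (ht : t ∈ Ioo (0 : ℝ) 1)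
    (heu : √3 / 2 ≤ ⟪e, u⟫) : t • u ∈ Metric.closedBall ((√3)⁻¹ • e) (√3)⁻¹ := by
  have h3 : √3 * √3 = 3 := Real.mul_self_sqrt (by norm_num)
  have h3' : 0 < √3 := by positivity
  have hinv : (√3)⁻¹ * √3 = 1 := inv_mul_cancel₀ h3'.ne'
  have hinv2 : (√3)⁻¹ ^ 2 = 1 / 3 := by rw [inv_pow, sq, h3]; norm_num
  rw [mem_closedBall_iff_norm]
  refine abs_le_of_sq_le_sq' ?_ (by positivity) |>.2
  rw [norm_sub_sq_real, norm_smul, norm_smul, he, hu, inner_smul_left, inner_smul_right,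
    real_inner_comm]
  simp only [Real.norm_eq_abs, mul_one, sq_abs, conj_trivial]
  have h4 : (√3)⁻¹ * (√3 / 2) ≤ (√3)⁻¹ * ⟪e, u⟫ := by gcongr
  have h5 : t * (1 / 2) ≤ t * ((√3)⁻¹ * ⟪e, u⟫) :=
    mul_le_mul_of_nonneg_left (by linarith [h4, hinv]) ht.1.le
  nlinarith [ht.1, ht.2]

/-- A double cone of half-angle `π / 6` contains an exponentially small part of the sphere. -/
theorem sphereUniform_doubleCone_le {d : ℕ} (hd : 0 < d) {R : ℝ} (hR : 0 < R)
    {ξ : EuclideanSpace ℝ (Fin d)} (hξ : ξ ≠ 0) :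
    sphereUniform d R {w | √3 / 2 * (‖ξ‖ * ‖w‖) ≤ |⟪ξ, w⟫|} ≤
      2 * ENNReal.ofReal (Real.exp (-(Real.log 3 / 2) * d)) := by
  have : Nontrivial (EuclideanSpace ℝ (Fin d)) :=
    Module.nontrivial_of_finrank_pos (R := ℝ) (by simpa using hd)
  set e := ‖ξ‖⁻¹ • ξ with he_def
  have hξ' : 0 < ‖ξ‖ := norm_pos_iff.2 hξ
  have he : ‖e‖ = 1 := by rw [he_def, norm_smul, norm_inv, norm_norm, inv_mul_cancel₀ hξ'.ne']
  rw [sphereUniform, Measure.map_apply (by fun_prop)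
    (measurableSet_le (by fun_prop) (by fun_prop)), Measure.smul_apply, smul_eq_mul]
  set A : Set (Metric.sphere (0 : EuclideanSpace ℝ (Fin d)) 1) := _ ⁻¹' _ with hA
  have hAm : MeasurableSet A := by
    refine measurableSet_preimage (by fun_prop) (measurableSet_le (by fun_prop) (by fun_prop))
  have hsub : Ioo (0 : ℝ) 1 • ((↑) '' A : Set (EuclideanSpace ℝ (Fin d))) ⊆
      Metric.closedBall ((√3)⁻¹ • e) (√3)⁻¹ ∪ Metric.closedBall ((√3)⁻¹ • -e) (√3)⁻¹ := by
    rintro _ ⟨t, ht, _, ⟨u, hu, rfl⟩, rfl⟩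
    have hu1 : ‖(u : EuclideanSpace ℝ (Fin d))‖ = 1 := by simp
    have hu' : √3 / 2 ≤ |⟪e, (u : EuclideanSpace ℝ (Fin d))⟫| := by
      simp only [hA, mem_preimage, mem_ofPred_eq, norm_smul, hu1, inner_smul_right, abs_mul,
        Real.norm_eq_abs, abs_of_pos hR] at hu
      rw [he_def, inner_smul_left, conj_trivial, abs_mul, abs_of_pos (inv_pos.2 hξ'),
        inv_mul_eq_div, le_div_iff₀ hξ']
      nlinarith
    rcases le_abs.1 hu' with h | h
    · exact Or.inl (smul_mem_closedBall_of_le_inner he hu1 ht h)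
    · exact Or.inr (smul_mem_closedBall_of_le_inner (by rwa [norm_neg]) hu1 ht
        (by rwa [inner_neg_left]))
  have hpow : ENNReal.ofReal ((√3)⁻¹ ^ d) =
      ENNReal.ofReal (Real.exp (-(Real.log 3 / 2) * d)) := by
    congr 1
    rw [mul_comm, Real.exp_nat_mul, Real.exp_neg, ← Real.log_sqrt (by norm_num),
      Real.exp_log (by positivity)]
  have hvol : (volume : Measure (EuclideanSpace ℝ (Fin d))).toSphere A ≤
      2 * ENNReal.ofReal (Real.exp (-(Real.log 3 / 2) * d)) *
        (volume : Measure (EuclideanSpace ℝ (Fin d))).toSphere univ := by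
    rw [Measure.toSphere_apply' _ hAm, Measure.toSphere_apply_univ, mul_left_comm]
    gcongr
    refine (measure_mono hsub).trans ((measure_union_le _ _).trans ?_)
    rw [Measure.addHaar_closedBall _ _ (by positivity), Measure.addHaar_closedBall _ _
      (by positivity), finrank_euclideanSpace_fin, hpow, ← two_mul, mul_assoc]
  refine (mul_le_mul_right hvol _).trans ?_
  rw [mul_left_comm, ENNReal.inv_mul_cancel _ (measure_ne_top _ _), mul_one]
  simp [-Measure.toSphere_apply_univ]

/-- Frequencies outside the double cone of half-angle `π / 6` about `w` are at distance at least
`|z| ‖w‖ / 2` from each multiple `z • w`. -/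
theorem abs_mul_le_norm_sub_of_notMem_doubleCone {V : Type*} [NormedAddCommGroup V]
    [InnerProductSpace ℝ V] {w ξ : V} {r : ℝ} (hw : ‖w‖ = 2 * r)
    (hξ : |⟪ξ, w⟫| < √3 / 2 * (‖ξ‖ * ‖w‖)) (z : ℝ) : |z| * r ≤ ‖ξ - z • w‖ := by
  have h3 : √3 * √3 = 3 := Real.mul_self_sqrt (by norm_num)
  refine abs_le_of_sq_le_sq' ?_ (by positivity) |>.2
  rw [norm_sub_sq_real, norm_smul, inner_smul_right, hw, mul_pow, mul_pow, Real.norm_eq_abs]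
  rw [hw] at hξ
  have h1 : z * ⟪ξ, w⟫ ≤ |z| * (√3 / 2 * (‖ξ‖ * (2 * r))) :=
    (le_abs_self _).trans (by rw [abs_mul]; gcongr)
  nlinarith [sq_nonneg (‖ξ‖ - √3 * (|z| * r)), sq_nonneg (|z| * r)]

end Sphere

/-! ### Approximation of periodic functions by trigonometric polynomials -/

section TrigonometricApproximation

/-- The trigonometric polynomial with coefficients `c z`, `z ∈ s`, as a function on `ℝ`. -/
noncomputable def trigPoly (s : Finset ℤ) (c : ℤ → ℂ) (t : ℝ) : ℂ :=
  ∑ z ∈ s, Real.fourierChar ((z : ℝ) * t) • c z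

theorem trigPoly_eq_fourier (s : Finset ℤ) (c : ℤ → ℂ) (t : ℝ) :
    trigPoly s c t = (∑ z ∈ s, c z • (fourier z : C(AddCircle (1 : ℝ), ℂ))) t := by
  simp only [trigPoly, ContinuousMap.coe_sum, Finset.sum_apply, ContinuousMap.coe_smul,
    Pi.smul_apply, fourier_coe_apply, Circle.smul_def, Real.fourierChar_apply, smul_eq_mul]
  refine Finset.sum_congr rfl fun z _ => ?_
  rw [mul_comm]
  congr 2
  push_cast
  ring

/-- Together with `norm_fourierCoeff_le`: the coefficients of a trigonometric polynomial are bounded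
by its supremum. -/
theorem fourierCoeff_sum_fourier (s : Finset ℤ) (c : ℤ → ℂ) {z : ℤ} (hz : z ∈ s) :
    fourierCoeff ⇑(∑ y ∈ s, c y • fourier y : C(AddCircle (1 : ℝ), ℂ)) z = c z := by
  have h : (⇑(∑ y ∈ s, c y • (fourier y : C(AddCircle (1 : ℝ), ℂ))) : AddCircle (1 : ℝ) → ℂ) =
      ∑ y ∈ s, c y • ⇑(fourier y : C(AddCircle (1 : ℝ), ℂ)) := by
    ext x; simp
  rw [h, fourierCoeff.sum]
  · simp only [Finset.sum_apply, fourierCoeff.const_smul, fourierCoeff_fourier]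
    simp [Pi.single_apply, hz]
  · intro y _
    exact ((c y • (fourier y : C(AddCircle (1 : ℝ), ℂ))).continuous.integrable_of_hasCompactSupport
      (HasCompactSupport.of_compactSpace _))

theorem norm_fourierCoeff_le (P : C(AddCircle (1 : ℝ), ℂ)) (z : ℤ) :
    ‖fourierCoeff P z‖ ≤ ‖P‖ := by
  rw [fourierCoeff]
  refine (norm_integral_le_of_norm_le_const (C := ‖P‖) (.of_forall fun t => ?_)).trans ?_
  · rw [norm_smul, fourier_apply, Circle.norm_coe, one_mul]
    exact P.norm_coe_le_norm t
  · simp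

theorem exists_trigPoly_near (g : C(AddCircle (1 : ℝ), ℂ)) {δ : ℝ} (hδ : 0 < δ) :
    ∃ (s : Finset ℤ) (c : ℤ → ℂ), 0 ∈ s ∧ (∀ t : ℝ, ‖trigPoly s c t - g t‖ ≤ δ) ∧
      (∀ z ∈ s, ‖c z‖ ≤ ‖g‖ + δ) ∧ c 0 = ∫ t in (0 : ℝ)..1, trigPoly s c t := by
  have hg : g ∈ (Submodule.span ℂ (range (@fourier 1))).topologicalClosure := by
    rw [span_fourier_closure_eq_top]; trivial
  rw [← SetLike.mem_coe, Submodule.topologicalClosure_coe, Metric.mem_closure_iff] at hg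
  obtain ⟨P, hP, hPg⟩ := hg δ hδ
  obtain ⟨c, rfl⟩ := (Finsupp.mem_span_range_iff_exists_finsupp).1 hP
  -- `0` is added to the frequencies so that the constant coefficient can be split off later
  set s := insert 0 c.support with hs
  have hsum : (c.sum fun i a => a • (fourier i : C(AddCircle (1 : ℝ), ℂ))) =
      ∑ z ∈ s, c z • (fourier z : C(AddCircle (1 : ℝ), ℂ)) :=
    Finsupp.sum_of_support_subset _ (Finset.subset_insert _ _) _ fun y _ =>
      zero_smul ℂ (fourier y : C(AddCircle (1 : ℝ), ℂ))
  rw [hsum, dist_comm, dist_eq_norm] at hPg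
  set P := ∑ z ∈ s, c z • (fourier z : C(AddCircle (1 : ℝ), ℂ)) with hPdef
  refine ⟨s, c, by simp [hs], fun t => ?_, fun z hz => ?_, ?_⟩
  · rw [trigPoly_eq_fourier]
    exact ((P - g).norm_coe_le_norm t).trans hPg.le
  · rw [← fourierCoeff_sum_fourier s c hz]
    refine (norm_fourierCoeff_le P z).trans ?_
    have := norm_add_le g (P - g)
    rw [add_sub_cancel] at this
    linarith
  · have h0 : c 0 = fourierCoeff P 0 := (fourierCoeff_sum_fourier s c (Finset.mem_insert_self 0 _)).symm
    rw [h0, fourierCoeff_eq_intervalIntegral _ _ 0]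
    simp [trigPoly_eq_fourier, hPdef]

/-- A bounded measurable function of period `1` is the limit almost everywhere of uniformly bounded
trigonometric polynomials, whose constant coefficients converge to its mean: mollify, and apply
the Stone-Weierstrass theorem. -/
theorem exists_trigPoly_tendsto {ψ : ℝ → ℝ} (hψ : Measurable ψ)
    (hb : ∀ t, ψ t ∈ Icc (-1 : ℝ) 1) (hper : Function.Periodic ψ 1) :
    ∃ (s : ℕ → Finset ℤ) (c : ℕ → ℤ → ℂ), (∀ n, 0 ∈ s n) ∧
      (∀ n t, ‖trigPoly (s n) (c n) t‖ ≤ 2) ∧ (∀ n, ∀ z ∈ s n, ‖c n z‖ ≤ 2) ∧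
      (∀ᵐ t : ℝ, Tendsto (fun n => trigPoly (s n) (c n) t) atTop (𝓝 (ψ t : ℂ))) ∧
      Tendsto (fun n => c n 0) atTop (𝓝 ((∫ t in (0 : ℝ)..1, ψ t : ℝ) : ℂ)) := by
  have hb' (t : ℝ) : ‖ψ t‖ ≤ 1 := by rw [Real.norm_eq_abs]; exact abs_le.2 (hb t)
  have hloc : LocallyIntegrable ψ volume :=
    (memLp_top_of_bound hψ.aestronglyMeasurable 1 (.of_forall hb')).locallyIntegrable le_top
  let φ : ℕ → ContDiffBump (0 : ℝ) := fun n =>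
    { rIn := 1 / ((n : ℝ) + 1) / 2
      rOut := 1 / ((n : ℝ) + 1)
      rIn_pos := by positivity
      rIn_lt_rOut := half_lt_self (by positivity) }
  let g : ℕ → ℝ → ℝ := fun n =>
    MeasureTheory.convolution ((φ n).normed volume) ψ (ContinuousLinearMap.lsmul ℝ ℝ) volume
  have hgt : ∀ᵐ t : ℝ, Tendsto (fun n => g n t) atTop (𝓝 (ψ t)) := by
    refine ContDiffBump.ae_convolution_tendsto_right_of_locallyIntegrable (K := 2)
      tendsto_one_div_add_atTop_nhds_zero_nat (.of_forall fun n => ?_) hloc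
    change 1 / ((n : ℝ) + 1) ≤ 2 * (1 / ((n : ℝ) + 1) / 2)
    linarith
  have hgc (n : ℕ) : Continuous (g n) :=
    (φ n).hasCompactSupport_normed.continuous_convolution_left _ (φ n).continuous_normed hloc
  have hgb (n : ℕ) (t : ℝ) : ‖g n t‖ ≤ 1 := by
    rw [← (φ n).integral_normed (μ := volume)]
    refine norm_integral_le_of_norm_le (φ n).integrable_normed (.of_forall fun x => ?_)
    rw [ContinuousLinearMap.lsmul_apply, norm_smul, Real.norm_of_nonneg ((φ n).nonneg_normed x)]
    exact mul_le_of_le_one_right ((φ n).nonneg_normed x) (hb' _)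
  have hgper (n : ℕ) : Function.Periodic (fun t => (g n t : ℂ)) 1 := fun t => by
    change ((∫ x, _ : ℝ) : ℂ) = ((∫ x, _ : ℝ) : ℂ)
    congr 2
    ext x
    rw [show t + 1 - x = t - x + 1 by ring, hper]
  let G : ℕ → C(AddCircle (1 : ℝ), ℂ) := fun n =>
    ⟨(hgper n).lift, continuous_coinduced_dom.2 (Complex.continuous_ofReal.comp (hgc n))⟩
  have hG (n : ℕ) (t : ℝ) : G n t = g n t := (hgper n).lift_coe t
  have hGn (n : ℕ) : ‖G n‖ ≤ 1 := by
    refine (ContinuousMap.norm_le _ zero_le_one).2 fun x => ?_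
    induction x using QuotientAddGroup.induction_on with
    | H t => exact (congrArg _ (hG n t)).trans_le (by simpa using hgb n t)
  choose s c hs0 happ hc hc0 using fun n : ℕ =>
    exists_trigPoly_near (G n) (δ := 1 / ((n : ℝ) + 1)) (by positivity)
  have hδ (n : ℕ) : 1 / ((n : ℝ) + 1) ≤ 1 := by
    rw [div_le_one (by positivity)]; linarith [n.cast_nonneg (α := ℝ)]
  have hbd (n : ℕ) (t : ℝ) : ‖trigPoly (s n) (c n) t‖ ≤ 2 := by
    have h1 := happ n t
    have h2 := norm_add_le (trigPoly (s n) (c n) t - G n t) (G n t)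
    rw [sub_add_cancel] at h2
    linarith [hδ n, hGn n, (G n).norm_coe_le_norm t]
  have hlim : ∀ᵐ t : ℝ, Tendsto (fun n => trigPoly (s n) (c n) t) atTop (𝓝 (ψ t : ℂ)) := by
    filter_upwards [hgt] with t ht
    have h1 : Tendsto (fun n => trigPoly (s n) (c n) t - G n t) atTop (𝓝 0) :=
      squeeze_zero_norm (fun n => happ n t) tendsto_one_div_add_atTop_nhds_zero_nat
    have h2 : Tendsto (fun n => G n t) atTop (𝓝 (ψ t : ℂ)) := by
      simp_rw [hG]
      exact (Complex.continuous_ofReal.tendsto _).comp ht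
    simpa using h1.add h2
  refine ⟨s, c, hs0, hbd, fun n z hz => (hc n z hz).trans (by linarith [hδ n, hGn n]), hlim, ?_⟩
  rw [← intervalIntegral.integral_ofReal]
  simp_rw [hc0]
  refine intervalIntegral.tendsto_integral_filter_of_dominated_convergence (fun _ => 2)
    (.of_forall fun n => ?_) (.of_forall fun n => .of_forall fun t _ => hbd n t)
    intervalIntegrable_const (hlim.mono fun t ht _ => ht)
  refine Continuous.aestronglyMeasurable ?_
  unfold trigPoly
  fun_prop

end TrigonometricApproximation

/-! ### The gradient of a mean square error -/

section Gradient

theorem eLpNorm_two_sq {X : Type*} [MeasurableSpace X] {F : Type*} [NormedAddCommGroup F]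
    (μ : Measure X) (f : X → F) : eLpNorm f 2 μ ^ 2 = ∫⁻ x, ‖f x‖ₑ ^ 2 ∂μ := by
  have := eLpNorm_nnreal_pow_eq_lintegral (f := f) (μ := μ) (p := 2) two_ne_zero
  simpa using this

theorem ofReal_integral_sq {X : Type*} [MeasurableSpace X] {μ : Measure X} {f : X → ℝ}
    (hf : MemLp f 2 μ) : ENNReal.ofReal (∫ x, f x ^ 2 ∂μ) = eLpNorm f 2 μ ^ 2 := by
  rw [eLpNorm_two_sq, ofReal_integral_eq_lintegral_ofReal hf.integrable_sq
    (.of_forall fun x => sq_nonneg _)]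
  refine lintegral_congr fun x => ?_
  rw [← Real.enorm_of_nonneg (sq_nonneg _), enorm_pow]

/-- A sequence that is bounded in `L²` and tends to `0` almost everywhere tends weakly to `0`. -/
theorem tendsto_integral_mul_of_bounded_of_tendsto_ae {X : Type*} [MeasurableSpace X]
    {μ : Measure X} [IsFiniteMeasure μ] {u : X → ℝ} (hu : MemLp u 2 μ) {Q : ℕ → X → ℝ} {C : ℝ≥0}
    (hQ : ∀ᶠ n in atTop, AEStronglyMeasurable (Q n) μ ∧ eLpNorm (Q n) 2 μ ≤ C)
    (hlim : ∀ᵐ x ∂μ, Tendsto (fun n => Q n x) atTop (𝓝 0)) :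
    Tendsto (fun n => ∫ x, u x * Q n x ∂μ) atTop (𝓝 0) := by
  obtain ⟨N, hN⟩ := eventually_atTop.1 hQ
  refine (tendsto_add_atTop_iff_nat N).1 ?_
  have hmem (n : ℕ) : MemLp (Q (n + N)) 2 μ :=
    ⟨(hN _ (by omega)).1, (hN _ (by omega)).2.trans_lt ENNReal.coe_lt_top⟩
  have hint (n : ℕ) : Integrable (u * Q (n + N)) μ := hu.integrable_mul (hmem n)
  have hUI : UnifIntegrable (fun n => u * Q (n + N)) 1 μ := by
    intro ε hε
    obtain ⟨δ, hδ, h⟩ := hu.eLpNorm_indicator_le one_le_two ENNReal.ofNat_ne_top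
      (ε := ε / (C + 1)) (by positivity)
    refine ⟨δ, hδ, fun n s hs hμs => ?_⟩
    have h1 : s.indicator (u * Q (n + N)) = s.indicator u • Q (n + N) := by
      ext x; by_cases hx : x ∈ s <;> simp [hx]
    rw [h1]
    refine (eLpNorm_smul_le_mul_eLpNorm (p := 2) (q := 2) (r := 1) (hmem n).1
      (hu.1.indicator hs)).trans ?_
    refine (mul_le_mul' (h s hs hμs) (hN _ (by omega)).2).trans ?_
    rw [← ENNReal.ofReal_coe_nnreal, ← ENNReal.ofReal_mul (by positivity)]
    refine ENNReal.ofReal_le_ofReal ?_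
    rw [div_mul_eq_mul_div, div_le_iff₀ (by positivity)]
    nlinarith [C.2]
  have hL1 := tendsto_Lp_finite_of_tendsto_ae le_rfl ENNReal.one_ne_top (g := 0)
    (fun n => (hint n).1) MemLp.zero' hUI (by
      filter_upwards [hlim] with x hx
      have := ((tendsto_add_atTop_iff_nat N).2 hx).const_mul (u x)
      simpa using this)
  simpa using tendsto_integral_of_L1' 0 aestronglyMeasurable_zero (.of_forall hint) hL1

variable {X : Type*} [MeasurableSpace X] {μ : Measure X} {k : ℕ}
  {f : EuclideanSpace ℝ (Fin k) → X → ℝ} {w : EuclideanSpace ℝ (Fin k)}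

/-- The gradient in the parameter is an almost everywhere limit of difference quotients, which are
measurable in `x`. -/
theorem aestronglyMeasurable_gradient
    (hmem : ∀ᶠ v in 𝓝 w, MemLp (f v) 2 μ)
    (hdiff : ∀ᵐ x ∂μ, DifferentiableAt ℝ (fun v => f v x) w) :
    AEStronglyMeasurable (fun x => gradient (fun v => f v x) w) μ := by
  let b := EuclideanSpace.basisFun (Fin k) ℝ
  have hc : Tendsto (fun n : ℕ => (n : ℝ)) atTop atTop := tendsto_natCast_atTop_atTop
  have hev : ∀ᶠ n : ℕ in atTop, ∀ j, MemLp (f (w + (n : ℝ)⁻¹ • b j)) 2 μ := by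
    refine eventually_all.2 fun j => ?_
    have h : Tendsto (fun n : ℕ => w + (n : ℝ)⁻¹ • b j) atTop (𝓝 (w + (0 : ℝ) • b j)) :=
      ((tendsto_inv_atTop_zero.comp hc).smul_const _).const_add _
    rw [zero_smul, add_zero] at h
    exact h.eventually hmem
  obtain ⟨N, hN⟩ := eventually_atTop.1 hev
  refine aestronglyMeasurable_of_tendsto_ae atTop (f := fun (n : ℕ) x =>
    ∑ j, (((n + N : ℕ) : ℝ) • (f (w + ((n + N : ℕ) : ℝ)⁻¹ • b j) x - f w x)) • b j)
    (fun n => ?_) ?_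
  · refine Finset.aestronglyMeasurable_fun_sum _ fun j _ => ?_
    have h : AEStronglyMeasurable (fun x => ((n + N : ℕ) : ℝ) •
        (f (w + ((n + N : ℕ) : ℝ)⁻¹ • b j) x - f w x)) μ :=
      ((hN (n + N) (by omega) j).1.sub hmem.self_of_nhds.1).const_smul ((n + N : ℕ) : ℝ)
    exact h.smul_const _
  · filter_upwards [hdiff] with x hx
    rw [← b.sum_repr' (gradient (fun v => f v x) w)]
    refine tendsto_finsetSum _ fun j _ => Tendsto.smul_const ?_ _
    rw [real_inner_comm, inner_gradient_left]
    refine hx.hasFDerivAt.lim (b j) ?_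
    exact tendsto_norm_atTop_atTop.comp ((tendsto_add_atTop_iff_nat N).2 hc)

theorem memLp_gradient (hmem : ∀ᶠ v in 𝓝 w, MemLp (f v) 2 μ)
    (hdiff : ∀ᵐ x ∂μ, DifferentiableAt ℝ (fun v => f v x) w) {G : ℝ≥0}
    (hG : ∫⁻ x, ‖gradient (fun v => f v x) w‖ₑ ^ 2 ∂μ ≤ G) :
    MemLp (fun x => gradient (fun v => f v x) w) 2 μ := by
  refine ⟨aestronglyMeasurable_gradient hmem hdiff, ?_⟩
  rw [← eLpNorm_two_sq] at hG
  exact lt_top_iff_ne_top.2 fun h => absurd hG (by simp [h])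

/-- Differentiation under the integral sign for the mean square error: the difference quotients of
`v ↦ f v` at `w` are bounded in `L²` and converge almost everywhere, hence weakly. -/
theorem hasGradientAt_integral_sub_sq [IsFiniteMeasure μ] {h : X → ℝ} (hh : MemLp h 2 μ)
    (hmem : ∀ᶠ v in 𝓝 w, MemLp (f v) 2 μ)
    {g : X → EuclideanSpace ℝ (Fin k)}
    (hdiff : ∀ᵐ x ∂μ, HasGradientAt (fun v => f v x) (g x) w)
    (hLip : ∃ K : ℝ≥0, ∀ᶠ v in 𝓝 w, eLpNorm (fun x => f v x - f w x) 2 μ ≤ K * ‖v - w‖ₑ)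
    (hgrad : MemLp g 2 μ) :
    HasGradientAt (fun v => ∫ x, (f v x - h x) ^ 2 ∂μ)
      ((2 : ℝ) • ∫ x, (f w x - h x) • g x ∂μ) w := by
  obtain ⟨K, hK⟩ := hLip
  have hw : MemLp (f w) 2 μ := hmem.self_of_nhds
  set u : X → ℝ := fun x => f w x - h x with hu_def
  have hu : MemLp u 2 μ := hw.sub hh
  have hug : Integrable (fun x => u x • g x) μ := memLp_one_iff_integrable.1 (hgrad.smul hu)
  let Q : EuclideanSpace ℝ (Fin k) → X → ℝ := fun v x =>
    ‖v - w‖⁻¹ * (f v x - f w x - ⟪g x, v - w⟫)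
  have hin (v : EuclideanSpace ℝ (Fin k)) : MemLp (fun x => ⟪g x, v - w⟫) 2 μ :=
    hgrad.inner_const _
  -- the quadratic remainder and the linear remainder tend to `0`
  have hlin : Tendsto (fun v => ∫ x, u x * Q v x ∂μ) (𝓝 w) (𝓝 0) := by
    refine tendsto_of_seq_tendsto fun v hv => ?_
    refine tendsto_integral_mul_of_bounded_of_tendsto_ae hu
      (C := K + (eLpNorm g 2 μ).toNNReal) ?_ ?_
    · filter_upwards [hv.eventually hmem, hv.eventually hK] with n hn hKn
      have hD : MemLp (fun x => f (v n) x - f w x) 2 μ := hn.sub hw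
      refine ⟨((hD.sub (hin (v n))).const_mul _).1, ?_⟩
      have h1 : eLpNorm (fun x => ⟪g x, v n - w⟫) 2 μ ≤ ‖v n - w‖ₑ * eLpNorm g 2 μ := by
        rw [← ofReal_norm]
        refine eLpNorm_le_mul_eLpNorm_of_ae_le_mul (.of_forall fun x => ?_) 2
        rw [mul_comm]
        exact norm_inner_le_norm _ _
      have h2 : eLpNorm (Q (v n)) 2 μ ≤
          ‖‖v n - w‖⁻¹‖ₑ * (K * ‖v n - w‖ₑ + ‖v n - w‖ₑ * eLpNorm g 2 μ) := by
        have hQv : Q (v n) = ‖v n - w‖⁻¹ • fun x => f (v n) x - f w x - ⟪g x, v n - w⟫ := rfl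
        rw [hQv, eLpNorm_const_smul]
        gcongr
        exact (eLpNorm_sub_le hD.1 (hin _).1 one_le_two).trans (add_le_add hKn h1)
      refine h2.trans ?_
      have h3 : ‖‖v n - w‖⁻¹‖ₑ * ‖v n - w‖ₑ ≤ 1 := by
        rw [← enorm_norm (v n - w), ← enorm_mul]
        exact (Real.enorm_eq_ofReal (by positivity)).trans_le
          (ENNReal.ofReal_le_one.2 inv_mul_le_one)
      push_cast
      rw [ENNReal.coe_toNNReal hgrad.2.ne, mul_comm (K : ℝ≥0∞), ← mul_add, ← mul_assoc]
      exact mul_le_of_le_one_left zero_le h3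
    · filter_upwards [hdiff] with x hx
      have := (hasGradientAt_iff_tendsto.1 hx).comp hv
      refine squeeze_zero_norm (fun n => ?_) this
      simp [Q]
  have hquad : Tendsto (fun v => ‖v - w‖⁻¹ * ∫ x, (f v x - f w x) ^ 2 ∂μ) (𝓝 w) (𝓝 0) := by
    have hz : Tendsto (fun v => (K : ℝ) ^ 2 * ‖v - w‖) (𝓝 w) (𝓝 0) := by
      have : Continuous fun v => (K : ℝ) ^ 2 * ‖v - w‖ := by fun_prop
      simpa using this.tendsto w
    refine squeeze_zero' (.of_forall fun v => ?_) ?_ hz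
    · exact mul_nonneg (by positivity) (integral_nonneg fun x => sq_nonneg _)
    · filter_upwards [hmem, hK] with v hv hKv
      have h1 : ∫ x, (f v x - f w x) ^ 2 ∂μ ≤ (K * ‖v - w‖) ^ 2 := by
        refine (ENNReal.ofReal_le_ofReal_iff (by positivity)).1 ?_
        have hD : MemLp (fun x => f v x - f w x) 2 μ := hv.sub hw
        rw [ofReal_integral_sq hD, ENNReal.ofReal_pow (by positivity),
          ENNReal.ofReal_mul (by positivity), ofReal_norm, ENNReal.ofReal_coe_nnreal]
        gcongr
      rcases (norm_nonneg (v - w)).eq_or_lt with h0 | h0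
      · simp [← h0]
      · rw [inv_mul_le_iff₀ h0]
        linarith
  rw [hasGradientAt_iff_tendsto]
  have hsum := hquad.add ((hlin.norm).const_mul 2)
  rw [norm_zero, mul_zero, add_zero] at hsum
  refine squeeze_zero' (.of_forall fun v => by positivity) ?_ hsum
  filter_upwards [hmem] with v hv
  have hD : MemLp (fun x => f v x - f w x) 2 μ := hv.sub hw
  have hR : MemLp (fun x => f v x - f w x - ⟪g x, v - w⟫) 2 μ := hD.sub (hin v)
  have huR : Integrable (fun x => u x * (f v x - f w x - ⟪g x, v - w⟫)) μ := hu.integrable_mul hR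
  have hexp : (∫ x, (f v x - h x) ^ 2 ∂μ) - (∫ x, (f w x - h x) ^ 2 ∂μ)
      - ⟪(2 : ℝ) • ∫ x, u x • g x ∂μ, v - w⟫ =
      (∫ x, (f v x - f w x) ^ 2 ∂μ) + 2 * ∫ x, u x * (f v x - f w x - ⟪g x, v - w⟫) ∂μ := by
    have h1 : ⟪(2 : ℝ) • ∫ x, u x • g x ∂μ, v - w⟫ = ∫ x, 2 * ⟪u x • g x, v - w⟫ ∂μ := by
      rw [inner_smul_left, integral_const_mul, real_inner_comm, ← integral_inner hug]
      simp only [real_inner_comm, conj_trivial]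
    have hI : Integrable (fun x => 2 * ⟪u x • g x, v - w⟫) μ := (hug.inner_const _).const_mul 2
    have hv2 : Integrable (fun x => (f v x - h x) ^ 2) μ := (hv.sub hh).integrable_sq
    have hw2 : Integrable (fun x => (f w x - h x) ^ 2) μ := (hw.sub hh).integrable_sq
    have hvw : Integrable (fun x => (f v x - h x) ^ 2 - (f w x - h x) ^ 2) μ := hv2.sub hw2
    rw [h1, ← integral_sub hv2 hw2, ← integral_sub hvw hI, ← integral_const_mul, ← integral_add
      hD.integrable_sq (huR.const_mul 2)]
    refine integral_congr_ae (.of_forall fun x => ?_)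
    simp only [inner_smul_left, conj_trivial, hu_def]
    ring
  have hQ : ∫ x, u x * Q v x ∂μ = ‖v - w‖⁻¹ * ∫ x, u x * (f v x - f w x - ⟪g x, v - w⟫) ∂μ := by
    rw [← integral_const_mul]
    exact integral_congr_ae (.of_forall fun x => by simp only [Q]; ring)
  rw [hexp, hQ, norm_mul, norm_inv, norm_norm]
  have h2 := norm_add_le (∫ x, (f v x - f w x) ^ 2 ∂μ)
    (2 * ∫ x, u x * (f v x - f w x - ⟪g x, v - w⟫) ∂μ)
  rw [Real.norm_of_nonneg (integral_nonneg fun x => sq_nonneg _), norm_mul, Real.norm_ofNat] at h2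
  refine (mul_le_mul_of_nonneg_left h2 (by positivity)).trans (le_of_eq (by ring))

end Gradient

/-! ### Correlations under one Fourier-concentrated density -/

section SingleDensity

theorem ENNReal.add_sq_le_two_mul (a b : ℝ≥0∞) : (a + b) ^ 2 ≤ 2 * (a ^ 2 + b ^ 2) := by
  have h := ENNReal.rpow_add_le_mul_rpow_add_rpow a b (p := 2) one_le_two
  rw [show (2 : ℝ) - 1 = 1 by norm_num, ENNReal.rpow_one] at h
  exact_mod_cast h

/-- The double cone of half-angle `π / 6` about the line spanned by `w`. -/
def doubleCone {V : Type*} [NormedAddCommGroup V] [InnerProductSpace ℝ V] (w : V) : Set V :=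
  {ξ | √3 / 2 * (‖ξ‖ * ‖w‖) ≤ |⟪ξ, w⟫|}

theorem measurableSet_doubleCone {d : ℕ} (w : EuclideanSpace ℝ (Fin d)) :
    MeasurableSet (doubleCone w) :=
  measurableSet_le (by fun_prop) (by fun_prop)

theorem sum_le_two_mul_tsum (a : ℝ → ℝ≥0∞) (s : Finset ℤ) :
    ∑ z ∈ s.erase 0, a |(z : ℝ)| ≤ 2 * ∑' n : ℕ, a ((n : ℝ) + 1) := by
  let b : ℤ → ℝ≥0∞ := fun z => if z = 0 then 0 else a |(z : ℝ)|
  have h1 : ∑ z ∈ s.erase 0, a |(z : ℝ)| = ∑ z ∈ s.erase 0, b z :=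
    Finset.sum_congr rfl fun z hz => by simp [b, Finset.ne_of_mem_erase hz]
  have h2 (n : ℕ) : b ((n + 1 : ℕ) : ℤ) = a ((n : ℝ) + 1) := by
    have h0 : ((n + 1 : ℕ) : ℤ) ≠ 0 := by omega
    have habs : |(n : ℝ) + 1| = (n : ℝ) + 1 := abs_of_nonneg (by positivity)
    simp only [b, h0, if_false]
    push_cast
    rw [habs]
  have h3 (n : ℕ) : b (-((n : ℤ) + 1)) = a ((n : ℝ) + 1) := by
    have h0 : -((n : ℤ) + 1) ≠ 0 := by omega
    have habs : |(n : ℝ) + 1| = (n : ℝ) + 1 := abs_of_nonneg (by positivity)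
    simp only [b, h0, if_false]
    push_cast
    rw [abs_neg, habs]
  rw [h1]
  refine (ENNReal.sum_le_tsum _).trans (le_of_eq ?_)
  rw [tsum_of_nat_of_neg_add_one ENNReal.summable ENNReal.summable,
    tsum_eq_zero_add' ENNReal.summable, two_mul]
  simp only [h2, h3]
  simp [b]

variable {d : ℕ} {ε : ℝ → ℝ} {φ h : EuclideanSpace ℝ (Fin d) → ℝ}
  {w : EuclideanSpace ℝ (Fin d)} {r : ℝ}

/-- The main estimate for trigonometric polynomials: on `doubleCone w` only the transform of `h` is
used, while off the cone each nonzero frequency `z` contributes at most `ε (|z| r)`. -/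
theorem enorm_integral_trigPoly_sub_le
    (hφ : IsFourierConcentrated ε φ) (hφ1 : eLpNorm (fun x => (φ x : ℂ)) 2 volume = 1)
    (hh : MemLp (fun x => (h x : ℂ)) 2 volume) (hr : 0 ≤ r) (hw : ‖w‖ = 2 * r)
    {s : Finset ℤ} {c : ℤ → ℂ} (h0 : 0 ∈ s) (hP : ∀ t, ‖trigPoly s c t‖ ≤ 2)
    (hc : ∀ z ∈ s, ‖c z‖ ≤ 2) :
    ‖∫ x, (trigPoly s c ⟪w, x⟫ - c 0) * (φ x * h x : ℂ)‖ₑ ≤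
      4 * eLpNorm ((doubleCone w).indicator (𝓕 (hh.toLp _) :
        Lp ℂ 2 (volume : Measure (EuclideanSpace ℝ (Fin d))))) 2 volume +
      4 * eLpNorm (fun x => (h x : ℂ)) 2 volume *
        ∑' n : ℕ, ENNReal.ofReal (ε (((n : ℝ) + 1) * r)) := by
  obtain ⟨hφm, hconc⟩ := hφ
  set F := hφm.toLp with hF
  set H := hh.toLp with hH
  have hFn : ‖F‖ₑ = 1 := by rw [hF, Lp.enorm_toLp, hφ1]
  have hFF : eLpNorm (𝓕 F : Lp ℂ 2 (volume : Measure (EuclideanSpace ℝ (Fin d)))) 2 volume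
      = 1 := by
    rw [← Lp.enorm_def, ← enorm_norm, Lp.norm_fourier_eq, enorm_norm, hFn]
  have herase (t : ℝ) : trigPoly (s.erase 0) c t = trigPoly s c t - c 0 := by
    rw [trigPoly, trigPoly, ← Finset.add_sum_erase s _ h0]
    simp
  have hB (x : EuclideanSpace ℝ (Fin d)) :
      ‖∑ z ∈ s.erase 0, Real.fourierChar ((z : ℝ) * ⟪w, x⟫) • c z‖ₑ ≤ (4 : ℝ≥0) := by
    change ‖trigPoly (s.erase 0) c ⟪w, x⟫‖ₑ ≤ _
    rw [herase, ← ofReal_norm]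
    refine ENNReal.ofReal_le_of_le_toReal ?_
    have := norm_sub_le (trigPoly s c ⟪w, x⟫) (c 0)
    have h4 : ((4 : ℝ≥0) : ℝ≥0∞).toReal = 4 := rfl
    rw [h4]
    linarith [hP ⟪w, x⟫, hc 0 h0]
  have key := enorm_inner_trigPoly_le F H w r (s.erase 0) c 4 hB (doubleCone w)
    (measurableSet_doubleCone w) fun z _ ξ hξ =>
      abs_mul_le_norm_sub_of_notMem_doubleCone hw (not_le.1 hξ) z
  have hinner : inner ℂ H (∑ z ∈ s.erase 0, c z • modulation ((z : ℝ) • w) F) =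
      ∫ x, (trigPoly s c ⟪w, x⟫ - c 0) * (φ x * h x : ℂ) := by
    rw [L2.inner_def]
    refine integral_congr_ae ?_
    have h1 : ∀ᵐ x, ∀ z ∈ s.erase 0, modulation ((z : ℝ) • w) F x =
        Real.fourierChar ⟪(z : ℝ) • w, x⟫ • F x :=
      (ae_ball_iff (s.erase 0).countable_toSet).2 fun z _ => coeFn_modulation _ F
    have h2 : ∀ᵐ x, ∀ z ∈ s.erase 0, (c z • modulation ((z : ℝ) • w) F :
        Lp ℂ 2 (volume : Measure (EuclideanSpace ℝ (Fin d)))) x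
        = c z * modulation ((z : ℝ) • w) F x :=
      (ae_ball_iff (s.erase 0).countable_toSet).2 fun z _ => Lp.coeFn_smul _ _
    filter_upwards [h1, h2, hφm.coeFn_toLp, hh.coeFn_toLp,
      Lp.coeFn_finsetSum (s.erase 0) (fun z => c z • modulation ((z : ℝ) • w) F)]
      with x h1 h2 h3 h4 h5
    rw [← herase, h5, Finset.sum_apply, Finset.sum_congr rfl fun z hz => h2 z hz,
      Finset.sum_congr rfl fun z hz => by rw [h1 z hz, mul_smul_comm, ← smul_mul_assoc],
      ← Finset.sum_mul, h3, h4, RCLike.inner_apply, Complex.conj_ofReal, trigPoly]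
    simp only [inner_smul_left, conj_trivial]
    ring
  rw [hinner, hFn, mul_one] at key
  refine key.trans (add_le_add (by simp) ?_)
  rw [hH, Lp.enorm_toLp, mul_comm 4, mul_assoc]
  gcongr
  calc ∑ z ∈ s.erase 0, ‖c z‖ₑ * eLpNorm ({ξ : EuclideanSpace ℝ (Fin d) |
        |(z : ℝ)| * r ≤ ‖ξ‖}.indicator (𝓕 F :
          Lp ℂ 2 (volume : Measure (EuclideanSpace ℝ (Fin d))))) 2 volume
      ≤ ∑ z ∈ s.erase 0, 2 * ENNReal.ofReal (ε (|(z : ℝ)| * r)) := by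
        refine Finset.sum_le_sum fun z hz => mul_le_mul' ?_ ?_
        · rw [← ofReal_norm]
          exact ENNReal.ofReal_le_of_le_toReal (hc z (Finset.mem_of_mem_erase hz))
        · refine (hconc _ (by positivity)).trans ?_
          rw [hFF, mul_one]
    _ = 2 * ∑ z ∈ s.erase 0, ENNReal.ofReal (ε (|(z : ℝ)| * r)) := by rw [Finset.mul_sum]
    _ ≤ 2 * (2 * ∑' n : ℕ, ENNReal.ofReal (ε (((n : ℝ) + 1) * r))) := by
        gcongr
        exact sum_le_two_mul_tsum (fun t => ENNReal.ofReal (ε (t * r))) s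
    _ = 4 * ∑' n : ℕ, ENNReal.ofReal (ε (((n : ℝ) + 1) * r)) := by
        rw [← mul_assoc]; norm_num

/-- A property of almost all `t : ℝ` holds at `⟨w, x⟩` for almost all `x`, if `w ≠ 0`. -/
theorem ae_inner_of_ae (hw : w ≠ 0) {p : ℝ → Prop} (hp : ∀ᵐ t, p t) :
    ∀ᵐ x : EuclideanSpace ℝ (Fin d), p ⟪w, x⟫ := by
  have hsurj : Function.Surjective (innerₛₗ ℝ w : EuclideanSpace ℝ (Fin d) →ₗ[ℝ] ℝ) := by
    refine LinearMap.surjective fun h => hw ?_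
    exact inner_self_eq_zero.1 (LinearMap.congr_fun h w)
  obtain ⟨t, ht, htm, ht0⟩ := exists_measurable_superset_of_null (ae_iff.1 hp)
  have h1 : ∀ᵐ y : ℝ, y ∈ tᶜ := by
    rw [ae_iff]; simpa using ht0
  filter_upwards [(ae_comp_linearMap_mem_iff (innerₛₗ ℝ w :
    EuclideanSpace ℝ (Fin d) →ₗ[ℝ] ℝ) volume volume hsurj htm.compl).2 h1] with x hx
  by_contra hcon
  exact hx (ht hcon)

/-- The estimate of `enorm_integral_trigPoly_sub_le` survives the limit of the trigonometric
polynomials approximating `ψ`. -/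
theorem enorm_integral_periodic_sub_le {ψ : ℝ → ℝ} (hψ : Measurable ψ)
    (hb : ∀ t, ψ t ∈ Icc (-1 : ℝ) 1) (hper : Function.Periodic ψ 1)
    (hφ : IsFourierConcentrated ε φ) (hφ1 : eLpNorm (fun x => (φ x : ℂ)) 2 volume = 1)
    (hh : MemLp (fun x => (h x : ℂ)) 2 volume) (hr : 0 < r) (hw : ‖w‖ = 2 * r) :
    ‖∫ x, (ψ ⟪w, x⟫ - ∫ t in (0 : ℝ)..1, ψ t) * (φ x * h x)‖ₑ ≤
      4 * eLpNorm ((doubleCone w).indicator (𝓕 (hh.toLp _) :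
        Lp ℂ 2 (volume : Measure (EuclideanSpace ℝ (Fin d))))) 2 volume +
      4 * eLpNorm (fun x => (h x : ℂ)) 2 volume *
        ∑' n : ℕ, ENNReal.ofReal (ε (((n : ℝ) + 1) * r)) := by
  obtain ⟨s, c, h0, hP, hc, hlim, hlim0⟩ := exists_trigPoly_tendsto hψ hb hper
  have hw0 : w ≠ 0 := norm_pos_iff.1 (by rw [hw]; positivity)
  obtain ⟨hφm, -⟩ := id hφ
  have hint : Integrable (fun x => (φ x * h x : ℂ)) volume := hφm.integrable_mul hh
  have hconv : Tendsto (fun n => ∫ x, (trigPoly (s n) (c n) ⟪w, x⟫ - c n 0) * (φ x * h x : ℂ))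
      atTop (𝓝 (∫ x, ((ψ ⟪w, x⟫ : ℂ) - ((∫ t in (0 : ℝ)..1, ψ t : ℝ) : ℂ)) *
        (φ x * h x : ℂ))) := by
    refine tendsto_integral_of_dominated_convergence (fun x => 4 * ‖(φ x * h x : ℂ)‖)
      (fun n => ?_) (hint.norm.const_mul 4) (fun n => .of_forall fun x => ?_) ?_
    · refine AEStronglyMeasurable.mul (Continuous.aestronglyMeasurable ?_) hint.1
      unfold trigPoly
      fun_prop
    · rw [norm_mul]
      gcongr
      have := norm_sub_le (trigPoly (s n) (c n) ⟪w, x⟫) (c n 0)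
      linarith [hP n ⟪w, x⟫, hc n 0 (h0 n)]
    · filter_upwards [ae_inner_of_ae hw0 hlim] with x hx
      exact (hx.sub hlim0).mul_const _
  have hreal : (∫ x, ((ψ ⟪w, x⟫ : ℂ) - ((∫ t in (0 : ℝ)..1, ψ t : ℝ) : ℂ)) *
      (φ x * h x : ℂ)) = ((∫ x, (ψ ⟪w, x⟫ - ∫ t in (0 : ℝ)..1, ψ t) * (φ x * h x) : ℝ) : ℂ) := by
    rw [← integral_complex_ofReal]
    push_cast
    rfl
  rw [hreal] at hconv
  have hen : ‖((∫ x, (ψ ⟪w, x⟫ - ∫ t in (0 : ℝ)..1, ψ t) * (φ x * h x) : ℝ) : ℂ)‖ₑ =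
      ‖∫ x, (ψ ⟪w, x⟫ - ∫ t in (0 : ℝ)..1, ψ t) * (φ x * h x)‖ₑ := by
    rw [← ofReal_norm, ← ofReal_norm, Complex.norm_real]
  rw [← hen]
  exact le_of_tendsto hconv.enorm (.of_forall fun n =>
    enorm_integral_trigPoly_sub_le hφ hφ1 hh hr.le hw (h0 n) (hP n) (hc n))

theorem abs_intervalIntegral_le_one {ψ : ℝ → ℝ} (hb : ∀ t, ψ t ∈ Icc (-1 : ℝ) 1) :
    |∫ t in (0 : ℝ)..1, ψ t| ≤ 1 := by
  have := intervalIntegral.norm_integral_le_of_norm_le_const (a := 0) (b := 1) (C := 1) (f := ψ)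
    fun t _ => by rw [Real.norm_eq_abs]; exact abs_le.2 (hb t)
  simpa using this

theorem abs_sub_mean_le {ψ : ℝ → ℝ} (hb : ∀ t, ψ t ∈ Icc (-1 : ℝ) 1) (u : ℝ) :
    |ψ u - ∫ t in (0 : ℝ)..1, ψ t| ≤ 2 :=
  (abs_sub _ _).trans (by linarith [abs_le.2 (hb u), abs_intervalIntegral_le_one hb])

/-- The bound by Cauchy-Schwarz alone, which suffices when the tails of `ε` are not summable to less
than `1`. -/
theorem enorm_integral_sub_mean_le {ψ : ℝ → ℝ} (hb : ∀ t, ψ t ∈ Icc (-1 : ℝ) 1)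
    (hφ : MemLp (fun x => (φ x : ℂ)) 2 volume)
    (hφ1 : eLpNorm (fun x => (φ x : ℂ)) 2 volume = 1)
    (hh : MemLp (fun x => (h x : ℂ)) 2 volume) :
    ‖∫ x, (ψ ⟪w, x⟫ - ∫ t in (0 : ℝ)..1, ψ t) * (φ x * h x)‖ₑ ≤
      2 * eLpNorm (fun x => (h x : ℂ)) 2 volume := by
  refine (enorm_integral_le_lintegral_enorm _).trans ?_
  calc ∫⁻ x, ‖(ψ ⟪w, x⟫ - ∫ t in (0 : ℝ)..1, ψ t) * (φ x * h x)‖ₑ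
      ≤ ∫⁻ x, 2 * ‖((fun x => (φ x : ℂ)) • fun x => (h x : ℂ)) x‖ₑ := by
        refine lintegral_mono fun x => ?_
        rw [enorm_mul]
        gcongr
        · rw [← ofReal_norm]
          exact ENNReal.ofReal_le_of_le_toReal (abs_sub_mean_le hb _)
        · simp only [Pi.smul_apply', smul_eq_mul]
          rw [← Complex.ofReal_mul, ← ofReal_norm, ← ofReal_norm, Complex.norm_real]
    _ = 2 * eLpNorm ((fun x => (φ x : ℂ)) • fun x => (h x : ℂ)) 1 volume := by
        rw [lintegral_const_mul' _ _ (by simp), eLpNorm_one_eq_lintegral_enorm]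
    _ ≤ 2 * (eLpNorm (fun x => (φ x : ℂ)) 2 volume * eLpNorm (fun x => (h x : ℂ)) 2 volume) := by
        gcongr
        exact eLpNorm_smul_le_mul_eLpNorm hh.1 hφ.1
    _ = _ := by rw [hφ1, one_mul]

/-- A concentration function is at least `1` at `0`. -/
theorem one_le_of_isFourierConcentrated (hφ : IsFourierConcentrated ε φ)
    (hφ1 : eLpNorm (fun x => (φ x : ℂ)) 2 volume = 1) : 1 ≤ ENNReal.ofReal (ε 0) := by
  obtain ⟨hφm, hconc⟩ := hφ
  have hFF : eLpNorm (𝓕 (hφm.toLp) : Lp ℂ 2 (volume : Measure (EuclideanSpace ℝ (Fin d)))) 2 volume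
      = 1 := by
    rw [← Lp.enorm_def, ← enorm_norm, Lp.norm_fourier_eq, enorm_norm, Lp.enorm_toLp, hφ1]
  have := hconc 0 le_rfl
  have huniv : {ξ : EuclideanSpace ℝ (Fin d) | 0 ≤ ‖ξ‖} = univ := by ext; simp
  rwa [huniv, indicator_univ, hFF, mul_one] at this

/-- By Tonelli, the mass of `H` on a random double cone is on average an exponentially small part
of the whole. -/
theorem lintegral_doubleCone_le (hd : 0 < d) (hr : 0 < r)
    (H : Lp ℂ 2 (volume : Measure (EuclideanSpace ℝ (Fin d)))) :
    ∫⁻ w, eLpNorm ((doubleCone w).indicator H) 2 volume ^ 2 ∂sphereUniform d (2 * r) ≤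
      2 * ENNReal.ofReal (Real.exp (-(Real.log 3 / 2) * d)) * eLpNorm H 2 volume ^ 2 := by
  have := isProbabilityMeasure_sphereUniform hd (2 * r)
  have : Nontrivial (EuclideanSpace ℝ (Fin d)) :=
    Module.nontrivial_of_finrank_pos (R := ℝ) (by simpa using hd)
  let S : Set (EuclideanSpace ℝ (Fin d) × EuclideanSpace ℝ (Fin d)) :=
    {p | √3 / 2 * (‖p.2‖ * ‖p.1‖) ≤ |⟪p.2, p.1⟫|}
  have hS : MeasurableSet S := measurableSet_le (by fun_prop) (by fun_prop)
  have hHm : Measurable fun ξ => ‖H ξ‖ₑ ^ 2 :=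
    (Lp.stronglyMeasurable H).enorm.pow_const 2
  have hind (w ξ : EuclideanSpace ℝ (Fin d)) : ‖(doubleCone w).indicator H ξ‖ₑ ^ 2 =
      S.indicator (fun _ => 1) (w, ξ) * ‖H ξ‖ₑ ^ 2 := by
    by_cases hx : ξ ∈ doubleCone w
    · rw [indicator_of_mem hx, indicator_of_mem (show (w, ξ) ∈ S from hx), one_mul]
    · rw [indicator_of_notMem hx, indicator_of_notMem (show (w, ξ) ∉ S from hx)]
      simp
  simp_rw [eLpNorm_two_sq, hind]
  rw [lintegral_lintegral_swap
    (((measurable_const.indicator hS).mul (hHm.comp measurable_snd)).aemeasurable),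
    ← lintegral_const_mul _ hHm]
  refine lintegral_mono_ae ?_
  have hne : ∀ᵐ ξ : EuclideanSpace ℝ (Fin d), ξ ≠ 0 := by simp [ae_iff]
  filter_upwards [hne] with ξ hξ
  have hSξ : Measurable fun w => S.indicator (fun _ => (1 : ℝ≥0∞)) (w, ξ) :=
    (measurable_const.indicator hS).comp (measurable_id.prodMk measurable_const)
  rw [lintegral_mul_const _ hSξ]
  gcongr
  refine le_trans (le_of_eq ?_) (sphereUniform_doubleCone_le hd (R := 2 * r) (by positivity) hξ)
  rw [← lintegral_indicator_one (measurableSet_le (by fun_prop) (by fun_prop))]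
  rfl

/-- For a single Fourier-concentrated density `φ²` and a test function `h`, the correlation of
`φ h` with `ψ(⟨w, ·⟩)`, less its mean, is small on average over the direction of `w`. -/
theorem lintegral_correlation_sq_le (hd : 0 < d) (hr : 0 ≤ r) {ψ : ℝ → ℝ} (hψ : Measurable ψ)
    (hb : ∀ t, ψ t ∈ Icc (-1 : ℝ) 1) (hper : Function.Periodic ψ 1)
    (hφ : IsFourierConcentrated ε φ) (hφ1 : eLpNorm (fun x => (φ x : ℂ)) 2 volume = 1)
    (hh : MemLp (fun x => (h x : ℂ)) 2 volume) :
    ∫⁻ w, ‖∫ x, (ψ ⟪w, x⟫ - ∫ t in (0 : ℝ)..1, ψ t) * (φ x * h x)‖ₑ ^ 2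
        ∂sphereUniform d (2 * r) ≤
      64 * eLpNorm (fun x => (h x : ℂ)) 2 volume ^ 2 *
        (ENNReal.ofReal (Real.exp (-(Real.log 3 / 2) * d)) +
          ∑' n : ℕ, ENNReal.ofReal (ε (((n : ℝ) + 1) * r))) := by
  have := isProbabilityMeasure_sphereUniform hd (2 * r)
  set τ := ∑' n : ℕ, ENNReal.ofReal (ε (((n : ℝ) + 1) * r)) with hτ
  set η := ENNReal.ofReal (Real.exp (-(Real.log 3 / 2) * d)) with hη
  set N := eLpNorm (fun x => (h x : ℂ)) 2 volume with hN
  -- if `τ < 1` then `τ ^ 2 ≤ τ`; this is also where `r = 0` is excluded, since `ε 0 ≥ 1`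
  rcases le_or_gt 1 τ with h1 | h1
  · calc _ ≤ ∫⁻ _, (2 * N) ^ 2 ∂sphereUniform d (2 * r) := by
          refine lintegral_mono fun w => ?_
          gcongr
          exact enorm_integral_sub_mean_le hb hφ.1 hφ1 hh
      _ = 4 * N ^ 2 * 1 := by
          rw [lintegral_const, measure_univ, mul_one, mul_one, mul_pow]; norm_num
      _ ≤ 64 * N ^ 2 * (η + τ) := by
          gcongr
          · norm_num
          · exact h1.trans le_add_self
  have hr' : 0 < r := by
    refine hr.lt_of_ne' fun h0 => h1.not_ge ?_
    refine (one_le_of_isFourierConcentrated hφ hφ1).trans ?_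
    rw [hτ]
    simp only [h0, mul_zero]
    exact ENNReal.le_tsum (f := fun _ : ℕ => ENNReal.ofReal (ε 0)) 0
  have hτ2 : τ ^ 2 ≤ τ := by
    rw [sq]; exact mul_le_of_le_one_left zero_le h1.le
  have hHN : eLpNorm (𝓕 (hh.toLp) : Lp ℂ 2 (volume : Measure (EuclideanSpace ℝ (Fin d)))) 2 volume
      = N := by
    rw [← Lp.enorm_def, ← enorm_norm, Lp.norm_fourier_eq, enorm_norm, Lp.enorm_toLp]
  have hcone := lintegral_doubleCone_le hd hr' (𝓕 (hh.toLp))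
  rw [hHN] at hcone
  calc _ ≤ ∫⁻ w, (32 * eLpNorm ((doubleCone w).indicator (𝓕 (hh.toLp _) :
        Lp ℂ 2 (volume : Measure (EuclideanSpace ℝ (Fin d))))) 2 volume ^ 2 + 32 * (N ^ 2 * τ))
          ∂sphereUniform d (2 * r) := by
        refine lintegral_mono_ae ?_
        filter_upwards [ae_norm_eq_sphereUniform d (R := 2 * r) (by positivity)] with w hw
        refine (pow_le_pow_left' (enorm_integral_periodic_sub_le hψ hb hper hφ hφ1 hh hr' hw)
          2).trans ((ENNReal.add_sq_le_two_mul _ _).trans ?_)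
        rw [mul_pow, mul_pow, mul_pow, mul_add, ← mul_assoc, ← mul_assoc, ← mul_assoc,
          ← mul_assoc, mul_assoc _ (N ^ 2), mul_assoc _ (N ^ 2)]
        norm_num
        gcongr
    _ = 32 * (∫⁻ w, eLpNorm ((doubleCone w).indicator (𝓕 (hh.toLp _) :
        Lp ℂ 2 (volume : Measure (EuclideanSpace ℝ (Fin d))))) 2 volume ^ 2
          ∂sphereUniform d (2 * r)) + 32 * (N ^ 2 * τ) := by
        rw [lintegral_add_right _ measurable_const, lintegral_const_mul' _ _ (by simp),
          lintegral_const, measure_univ, mul_one]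
    _ ≤ 32 * (2 * η * N ^ 2) + 64 * (N ^ 2 * τ) := by
        gcongr
        norm_num
    _ = 64 * N ^ 2 * (η + τ) := by ring

end SingleDensity

/-! ### Correlations under a mixture -/

section Mixture

variable {d : ℕ} {ε : ℝ → ℝ}

theorem aestronglyMeasurable_of_complex {φ : EuclideanSpace ℝ (Fin d) → ℝ}
    (hφ : AEStronglyMeasurable (fun x => (φ x : ℂ)) volume) : AEStronglyMeasurable φ volume :=
  Complex.continuous_re.comp_aestronglyMeasurable hφ

theorem eLpNorm_complex_ofReal (φ : EuclideanSpace ℝ (Fin d) → ℝ) :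
    eLpNorm (fun x => (φ x : ℂ)) 2 volume = eLpNorm φ 2 volume :=
  eLpNorm_congr_norm_ae (.of_forall fun _ => Complex.norm_real _)

theorem aemeasurable_ofReal_sq {φ : EuclideanSpace ℝ (Fin d) → ℝ}
    (hφ : AEStronglyMeasurable φ volume) :
    AEMeasurable (fun x => ENNReal.ofReal (φ x ^ 2)) volume :=
  (hφ.aemeasurable.pow_const 2).ennreal_ofReal

theorem ofReal_sq_eq_enorm_sq (a : ℝ) : ENNReal.ofReal (a ^ 2) = ‖a‖ₑ ^ 2 := by
  rw [← Real.enorm_of_nonneg (sq_nonneg _), enorm_pow]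

theorem IsFourierConcentrated.eLpNorm_eq_one {φ : EuclideanSpace ℝ (Fin d) → ℝ}
    (hφ : IsFourierConcentrated ε φ) (h1 : ∫ x, φ x ^ 2 = 1) :
    eLpNorm (fun x => (φ x : ℂ)) 2 volume = 1 := by
  have hm : MemLp φ 2 volume :=
    ⟨aestronglyMeasurable_of_complex hφ.1.1, eLpNorm_complex_ofReal φ ▸ hφ.1.2⟩
  have h := ofReal_integral_sq hm
  rw [h1, ENNReal.ofReal_one] at h
  rw [eLpNorm_complex_ofReal]
  exact (ENNReal.pow_right_strictMono two_ne_zero).injective (by simpa using h.symm)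

theorem IsFourierConcentrated.isProbabilityMeasure_withDensity {φ : EuclideanSpace ℝ (Fin d) → ℝ}
    (hφ : IsFourierConcentrated ε φ) (h1 : ∫ x, φ x ^ 2 = 1) :
    IsProbabilityMeasure (volume.withDensity fun x => ENNReal.ofReal (φ x ^ 2)) := by
  constructor
  rw [withDensity_apply _ MeasurableSet.univ, Measure.restrict_univ]
  simp_rw [ofReal_sq_eq_enorm_sq]
  rw [← eLpNorm_two_sq, ← eLpNorm_complex_ofReal, hφ.eLpNorm_eq_one h1, one_pow]

theorem mixtureMeasure_eq_sum {ι : Type} [Countable ι] {α : ι → ℝ}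
    {φ : ι → EuclideanSpace ℝ (Fin d) → ℝ} (hα : ∀ i, 0 ≤ α i)
    (hφ : ∀ i, AEStronglyMeasurable (φ i) volume) :
    mixtureMeasure α φ = Measure.sum fun i => ENNReal.ofReal (α i) •
      volume.withDensity fun x => ENNReal.ofReal (φ i x ^ 2) := by
  have hmeas (i : ι) : Measurable fun x => ENNReal.ofReal ((hφ i).mk _ x ^ 2) :=
    ((hφ i).stronglyMeasurable_mk.measurable.pow_const 2).ennreal_ofReal
  have hcongr (i : ι) : (volume.withDensity fun x => ENNReal.ofReal (φ i x ^ 2)) =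
      volume.withDensity fun x => ENNReal.ofReal ((hφ i).mk _ x ^ 2) :=
    withDensity_congr_ae ((hφ i).ae_eq_mk.mono fun x hx => by simp only [hx])
  simp_rw [hcongr, ← withDensity_smul _ (hmeas _)]
  rw [← withDensity_tsum fun i => (hmeas i).const_smul _, mixtureMeasure]
  refine withDensity_congr_ae ?_
  filter_upwards [ae_all_iff.2 fun i => (hφ i).ae_eq_mk] with x hx
  rw [tsum_apply (Pi.summable.2 fun _ => ENNReal.summable)]
  refine tsum_congr fun i => ?_
  rw [hx i, ENNReal.ofReal_mul (hα i)]
  rfl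

/-- The estimate `lintegral_correlation_sq_le` for `h = φ g`, with integrals against the measure of
density `φ²`. -/
theorem lintegral_correlation_component_sq_le {φ : EuclideanSpace ℝ (Fin d) → ℝ} {r : ℝ}
    (hd : 0 < d) (hr : 0 ≤ r) {ψ : ℝ → ℝ} (hψ : Measurable ψ)
    (hb : ∀ t, ψ t ∈ Icc (-1 : ℝ) 1) (hper : Function.Periodic ψ 1)
    (hφ : IsFourierConcentrated ε φ) (h1 : ∫ x, φ x ^ 2 = 1)
    {g : EuclideanSpace ℝ (Fin d) → ℝ} (hg : StronglyMeasurable g) :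
    ∫⁻ w, ‖∫ x, (ψ ⟪w, x⟫ - ∫ t in (0 : ℝ)..1, ψ t) * g x
        ∂(volume.withDensity fun x => ENNReal.ofReal (φ x ^ 2))‖ₑ ^ 2 ∂sphereUniform d (2 * r) ≤
      64 * (∫⁻ x, ‖g x‖ₑ ^ 2 ∂(volume.withDensity fun x => ENNReal.ofReal (φ x ^ 2))) *
        (ENNReal.ofReal (Real.exp (-(Real.log 3 / 2) * d)) +
          ∑' n : ℕ, ENNReal.ofReal (ε (((n : ℝ) + 1) * r))) := by
  set ν := volume.withDensity fun x => ENNReal.ofReal (φ x ^ 2) with hν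
  set B := ENNReal.ofReal (Real.exp (-(Real.log 3 / 2) * d)) +
          ∑' n : ℕ, ENNReal.ofReal (ε (((n : ℝ) + 1) * r)) with hB
  have hB0 : B ≠ 0 := by
    have : 0 < ENNReal.ofReal (Real.exp (-(Real.log 3 / 2) * d)) :=
      ENNReal.ofReal_pos.2 (Real.exp_pos _)
    exact (this.trans_le le_self_add).ne'
  -- a component of weight `0` may see a `g` that is not square integrable
  by_cases htop : ∫⁻ x, ‖g x‖ₑ ^ 2 ∂ν = ∞
  · rw [htop, ENNReal.mul_top (by norm_num), ENNReal.top_mul hB0]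
    exact le_top
  have hφm := aestronglyMeasurable_of_complex hφ.1.1
  have hhm : AEStronglyMeasurable (fun x => φ x * g x) volume := hφm.mul hg.aestronglyMeasurable
  have hnorm : eLpNorm (fun x => ((φ x * g x : ℝ) : ℂ)) 2 volume ^ 2 =
      ∫⁻ x, ‖g x‖ₑ ^ 2 ∂ν := by
    rw [eLpNorm_complex_ofReal, eLpNorm_two_sq, hν, lintegral_withDensity_eq_lintegral_mul₀
      (aemeasurable_ofReal_sq hφm) (hg.enorm.pow_const 2).aemeasurable]
    refine lintegral_congr fun x => ?_
    rw [enorm_mul, mul_pow, Pi.mul_apply, ofReal_sq_eq_enorm_sq]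
  have hh : MemLp (fun x => ((φ x * g x : ℝ) : ℂ)) 2 volume := by
    refine ⟨Complex.continuous_ofReal.comp_aestronglyMeasurable hhm, ?_⟩
    refine lt_top_iff_ne_top.2 fun h => htop ?_
    rw [← hnorm, h]; simp
  have key := lintegral_correlation_sq_le hd hr hψ hb hper hφ (hφ.eLpNorm_eq_one h1) hh
  rw [hnorm] at key
  refine le_trans (le_of_eq (lintegral_congr fun w => ?_)) key
  rw [hν, integral_withDensity_eq_integral_toReal_smul₀ (aemeasurable_ofReal_sq hφm)
    (.of_forall fun x => ENNReal.ofReal_lt_top)]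
  congr 2
  refine integral_congr_ae (.of_forall fun x => ?_)
  simp only [ENNReal.toReal_ofReal (sq_nonneg _), smul_eq_mul]
  ring

/-- Jensen's inequality for the square and a countable convex combination. -/
theorem sq_tsum_mul_le {ι : Type} {p x : ι → ℝ≥0∞} (hp : ∑' i, p i = 1) :
    (∑' i, p i * x i) ^ 2 ≤ ∑' i, p i * x i ^ 2 := by
  let _ : MeasurableSpace ι := ⊤
  let P : Measure ι := Measure.sum fun i => p i • Measure.dirac i
  have hl (y : ι → ℝ≥0∞) : ∫⁻ i, y i ∂P = ∑' i, p i * y i := by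
    rw [lintegral_sum_measure]
    exact tsum_congr fun i => by rw [lintegral_smul_measure, lintegral_dirac, smul_eq_mul]
  have hP : IsProbabilityMeasure P := ⟨by simpa [hp] using hl fun _ => 1⟩
  have h := eLpNorm_le_eLpNorm_of_exponent_le (μ := P) (f := x) one_le_two
    measurable_from_top.aestronglyMeasurable
  have h2 := eLpNorm_nnreal_pow_eq_lintegral (f := x) (μ := P) (p := 2) two_ne_zero
  have h2' : eLpNorm x 2 P ^ 2 = ∫⁻ i, x i ^ 2 ∂P := by simpa using h2
  rw [eLpNorm_one_eq_lintegral_enorm] at h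
  calc (∑' i, p i * x i) ^ 2 = (∫⁻ i, ‖x i‖ₑ ∂P) ^ 2 := by rw [← hl]; rfl
    _ ≤ eLpNorm x 2 P ^ 2 := by gcongr
    _ = _ := by rw [h2', hl]

variable {ι : Type} [Countable ι] {α : ι → ℝ} {φ : ι → EuclideanSpace ℝ (Fin d) → ℝ} {r : ℝ}

theorem isProbabilityMeasure_mixtureMeasure (hα : ∀ i, 0 ≤ α i) (hα1 : HasSum α 1)
    (h1 : ∀ i, ∫ x, φ i x ^ 2 = 1) (hφ : ∀ i, IsFourierConcentrated ε (φ i)) :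
    IsProbabilityMeasure (mixtureMeasure α φ) := by
  have hP (i : ι) := (hφ i).isProbabilityMeasure_withDensity (h1 i)
  constructor
  rw [mixtureMeasure_eq_sum hα fun i => aestronglyMeasurable_of_complex (hφ i).1.1,
    Measure.sum_apply _ MeasurableSet.univ]
  simp only [Measure.smul_apply, measure_univ, smul_eq_mul, mul_one]
  rw [← ENNReal.ofReal_tsum_of_nonneg hα hα1.summable, hα1.tsum_eq, ENNReal.ofReal_one]

theorem measurable_sub_mean_mul {ψ : ℝ → ℝ} (hψ : Measurable ψ)
    {g : EuclideanSpace ℝ (Fin d) → ℝ} (hg : StronglyMeasurable g)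
    (ν : Measure (EuclideanSpace ℝ (Fin d))) [SFinite ν] :
    Measurable fun w => ∫ x, (ψ ⟪w, x⟫ - ∫ t in (0 : ℝ)..1, ψ t) * g x ∂ν := by
  refine (StronglyMeasurable.integral_prod_right (f := fun w x =>
    (ψ ⟪w, x⟫ - ∫ t in (0 : ℝ)..1, ψ t) * g x) ?_).measurable
  refine Measurable.stronglyMeasurable ?_
  exact ((hψ.comp (by fun_prop)).sub_const _).mul (hg.measurable.comp measurable_snd)

theorem integrable_sub_mean_smul {ψ : ℝ → ℝ} (hψ : Measurable ψ)
    (hb : ∀ t, ψ t ∈ Icc (-1 : ℝ) 1) {ν : Measure (EuclideanSpace ℝ (Fin d))}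
    {F : Type*} [NormedAddCommGroup F] [NormedSpace ℝ F]
    {g : EuclideanSpace ℝ (Fin d) → F} (hg : Integrable g ν)
    (w : EuclideanSpace ℝ (Fin d)) :
    Integrable (fun x => (ψ ⟪w, x⟫ - ∫ t in (0 : ℝ)..1, ψ t) • g x) ν :=
  hg.bdd_smul 2 ((hψ.comp (by fun_prop)).sub_const _).aestronglyMeasurable
    (.of_forall fun x => abs_sub_mean_le hb _)

/-- Passage to the mixture, by Jensen's inequality over the components. -/
theorem lintegral_correlation_mixture_sq_le (hd : 0 < d) (hr : 0 ≤ r) {ψ : ℝ → ℝ}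
    (hψ : Measurable ψ) (hb : ∀ t, ψ t ∈ Icc (-1 : ℝ) 1) (hper : Function.Periodic ψ 1)
    (hα : ∀ i, 0 ≤ α i) (hα1 : HasSum α 1)
    (h1 : ∀ i, ∫ x, φ i x ^ 2 = 1) (hφ : ∀ i, IsFourierConcentrated ε (φ i))
    {g : EuclideanSpace ℝ (Fin d) → ℝ} (hg : StronglyMeasurable g)
    (hgi : Integrable g (mixtureMeasure α φ)) :
    ∫⁻ w, ‖∫ x, (ψ ⟪w, x⟫ - ∫ t in (0 : ℝ)..1, ψ t) * g x ∂(mixtureMeasure α φ)‖ₑ ^ 2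
        ∂sphereUniform d (2 * r) ≤
      64 * (∫⁻ x, ‖g x‖ₑ ^ 2 ∂(mixtureMeasure α φ)) *
        (ENNReal.ofReal (Real.exp (-(Real.log 3 / 2) * d)) +
          ∑' n : ℕ, ENNReal.ofReal (ε (((n : ℝ) + 1) * r))) := by
  set B := ENNReal.ofReal (Real.exp (-(Real.log 3 / 2) * d)) +
          ∑' n : ℕ, ENNReal.ofReal (ε (((n : ℝ) + 1) * r)) with hB
  have hP (i : ι) := (hφ i).isProbabilityMeasure_withDensity (h1 i)
  set ν : ι → Measure (EuclideanSpace ℝ (Fin d)) := fun i =>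
    volume.withDensity fun x => ENNReal.ofReal (φ i x ^ 2) with hν
  have hμ : mixtureMeasure α φ = Measure.sum fun i => ENNReal.ofReal (α i) • ν i :=
    mixtureMeasure_eq_sum hα fun i => aestronglyMeasurable_of_complex (hφ i).1.1
  have hsum : ∑' i, ENNReal.ofReal (α i) = 1 := by
    rw [← ENNReal.ofReal_tsum_of_nonneg hα hα1.summable, hα1.tsum_eq, ENNReal.ofReal_one]
  let V : ι → EuclideanSpace ℝ (Fin d) → ℝ := fun i w =>
    ∫ x, (ψ ⟪w, x⟫ - ∫ t in (0 : ℝ)..1, ψ t) * g x ∂(ν i)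
  have hVm (i : ι) : Measurable (V i) := measurable_sub_mean_mul hψ hg (ν i)
  have hV (w : EuclideanSpace ℝ (Fin d)) :
      ‖∫ x, (ψ ⟪w, x⟫ - ∫ t in (0 : ℝ)..1, ψ t) * g x ∂(mixtureMeasure α φ)‖ₑ ≤
        ∑' i, ENNReal.ofReal (α i) * ‖V i w‖ₑ := by
    have hi := integrable_sub_mean_smul hψ hb hgi w
    rw [hμ] at hi ⊢
    have := hasSum_integral_measure hi
    simp only [smul_eq_mul] at this
    rw [← this.tsum_eq]
    refine enorm_tsum_le_tsum_enorm.trans (le_of_eq (tsum_congr fun i => ?_))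
    rw [integral_smul_measure, enorm_smul, ENNReal.toReal_ofReal (hα i),
      Real.enorm_of_nonneg (hα i)]
  calc _ ≤ ∫⁻ w, ∑' i, ENNReal.ofReal (α i) * ‖V i w‖ₑ ^ 2 ∂sphereUniform d (2 * r) :=
        lintegral_mono fun w => (pow_le_pow_left' (hV w) 2).trans (sq_tsum_mul_le hsum)
    _ = ∑' i, ENNReal.ofReal (α i) * ∫⁻ w, ‖V i w‖ₑ ^ 2 ∂sphereUniform d (2 * r) := by
        rw [lintegral_tsum fun i => (((hVm i).enorm.pow_const 2).const_mul _).aemeasurable]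
        exact tsum_congr fun i => lintegral_const_mul _ ((hVm i).enorm.pow_const 2)
    _ ≤ ∑' i, ENNReal.ofReal (α i) * (64 * (∫⁻ x, ‖g x‖ₑ ^ 2 ∂(ν i)) * B) := by
        gcongr with i
        exact lintegral_correlation_component_sq_le hd hr hψ hb hper (hφ i) (h1 i) hg
    _ = 64 * (∑' i, ENNReal.ofReal (α i) * ∫⁻ x, ‖g x‖ₑ ^ 2 ∂(ν i)) * B := by
        rw [← ENNReal.tsum_mul_left, ← ENNReal.tsum_mul_right]
        exact tsum_congr fun i => by ring
    _ = _ := by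
        rw [hμ, lintegral_sum_measure]
        simp only [lintegral_smul_measure, smul_eq_mul]

theorem EuclideanSpace.enorm_sq_eq {k : ℕ} (x : EuclideanSpace ℝ (Fin k)) :
    ‖x‖ₑ ^ 2 = ∑ j, ‖x j‖ₑ ^ 2 := by
  rw [← ofReal_norm, ← ENNReal.ofReal_pow (norm_nonneg _), EuclideanSpace.norm_sq_eq,
    ENNReal.ofReal_sum_of_nonneg fun j _ => by positivity]
  exact Finset.sum_congr rfl fun j _ => by
    rw [ENNReal.ofReal_pow (norm_nonneg _), ofReal_norm]

/-- The correlation of a vector-valued `g` with `ψ(⟨w, ·⟩)`, less its mean, as a function of `w`. -/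
noncomputable def correlation {k : ℕ} (μ : Measure (EuclideanSpace ℝ (Fin d))) (ψ : ℝ → ℝ)
    (g : EuclideanSpace ℝ (Fin d) → EuclideanSpace ℝ (Fin k)) (w : EuclideanSpace ℝ (Fin d)) :
    EuclideanSpace ℝ (Fin k) :=
  ∫ x, (ψ ⟪w, x⟫ - ∫ t in (0 : ℝ)..1, ψ t) • g x ∂μ

theorem correlation_congr {k : ℕ} {μ : Measure (EuclideanSpace ℝ (Fin d))} {ψ : ℝ → ℝ}
    {g g' : EuclideanSpace ℝ (Fin d) → EuclideanSpace ℝ (Fin k)} (h : g =ᵐ[μ] g') :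
    correlation μ ψ g = correlation μ ψ g' :=
  funext fun _ => integral_congr_ae (h.mono fun x hx => by simp only [hx])

theorem measurable_correlation {k : ℕ} {μ : Measure (EuclideanSpace ℝ (Fin d))} [SFinite μ]
    {ψ : ℝ → ℝ} (hψ : Measurable ψ) {g : EuclideanSpace ℝ (Fin d) → EuclideanSpace ℝ (Fin k)}
    (hg : AEStronglyMeasurable g μ) : Measurable (correlation μ ψ g) := by
  rw [correlation_congr hg.ae_eq_mk]
  refine (StronglyMeasurable.integral_prod_right (f := fun w x =>
    (ψ ⟪w, x⟫ - ∫ t in (0 : ℝ)..1, ψ t) • hg.mk g x) ?_).measurable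
  refine Measurable.stronglyMeasurable ?_
  exact ((hψ.comp (by fun_prop)).sub_const _).smul
    (hg.stronglyMeasurable_mk.measurable.comp measurable_snd)

/-- The variance of the gradient over the direction of the target: the scalar estimate is summed
over the coordinates of `g`. -/
theorem lintegral_enorm_correlation_sq_le {k : ℕ} (hd : 0 < d) (hr : 0 ≤ r) {ψ : ℝ → ℝ}
    (hψ : Measurable ψ) (hb : ∀ t, ψ t ∈ Icc (-1 : ℝ) 1) (hper : Function.Periodic ψ 1)
    (hα : ∀ i, 0 ≤ α i) (hα1 : HasSum α 1)
    (h1 : ∀ i, ∫ x, φ i x ^ 2 = 1) (hφ : ∀ i, IsFourierConcentrated ε (φ i))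
    {g : EuclideanSpace ℝ (Fin d) → EuclideanSpace ℝ (Fin k)}
    (hg : MemLp g 2 (mixtureMeasure α φ)) :
    ∫⁻ w, ‖correlation (mixtureMeasure α φ) ψ g w‖ₑ ^ 2 ∂sphereUniform d (2 * r) ≤
      64 * (∫⁻ x, ‖g x‖ₑ ^ 2 ∂(mixtureMeasure α φ)) *
        (ENNReal.ofReal (Real.exp (-(Real.log 3 / 2) * d)) +
          ∑' n : ℕ, ENNReal.ofReal (ε (((n : ℝ) + 1) * r))) := by
  have hP := isProbabilityMeasure_mixtureMeasure hα hα1 h1 hφ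
  set μ := mixtureMeasure α φ with hμ
  set g' := hg.1.mk g with hg'
  have hgg' : g =ᵐ[μ] g' := hg.1.ae_eq_mk
  have hg'm : StronglyMeasurable g' := hg.1.stronglyMeasurable_mk
  have hg'L : Integrable g' μ := ((memLp_congr_ae hgg').1 hg).integrable one_le_two
  rw [correlation_congr hgg', lintegral_congr_ae (hgg'.mono fun x hx => by rw [hx])]
  have hj (j : Fin k) : StronglyMeasurable fun x => g' x j :=
    (EuclideanSpace.proj (𝕜 := ℝ) j).continuous.comp_stronglyMeasurable hg'm
  have hji (j : Fin k) : Integrable (fun x => g' x j) μ :=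
    (EuclideanSpace.proj (𝕜 := ℝ) j).integrable_comp hg'L
  have hcoord (w : EuclideanSpace ℝ (Fin d)) (j : Fin k) : correlation μ ψ g' w j =
      ∫ x, (ψ ⟪w, x⟫ - ∫ t in (0 : ℝ)..1, ψ t) * g' x j ∂μ :=
    ((EuclideanSpace.proj (𝕜 := ℝ) j).integral_comp_comm
      (integrable_sub_mean_smul hψ hb hg'L w)).symm
  simp_rw [EuclideanSpace.enorm_sq_eq, hcoord]
  rw [lintegral_finsetSum _ fun j _ => (measurable_sub_mean_mul hψ (hj j) μ).enorm.pow_const 2,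
    lintegral_finsetSum _ fun j _ => (hj j).enorm.pow_const 2, Finset.mul_sum, Finset.sum_mul]
  exact Finset.sum_le_sum fun j _ =>
    lintegral_correlation_mixture_sq_le hd hr hψ hb hper hα hα1 h1 hφ (hj j) (hji j)

end Mixture

/-! ### Algorithms with an uninformative oracle -/

section Oracle

/-- Chebyshev's inequality, in the form that makes the accuracy of the oracle a cube root. -/
theorem measure_lt_le_of_lintegral_sq_le_cube {X : Type*} [MeasurableSpace X] {σ : Measure X}
    [IsProbabilityMeasure σ] {Y : X → ℝ≥0∞} (hY : Measurable Y) {a : ℝ≥0∞}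
    (h : ∫⁻ x, Y x ^ 2 ∂σ ≤ a ^ 3) : σ {x | a < Y x} ≤ a := by
  rcases eq_or_ne a 0 with rfl | h0
  · rw [zero_pow three_ne_zero, nonpos_iff_eq_zero, lintegral_eq_zero_iff (hY.pow_const 2)] at h
    rw [nonpos_iff_eq_zero]
    have h' : ∀ᵐ x ∂σ, ¬0 < Y x := h.mono fun x hx => by simpa using hx
    simpa only [ae_iff, not_not] using h'
  rcases eq_or_ne a ∞ with rfl | htop
  · exact le_top
  have h1 := mul_meas_ge_le_lintegral (μ := σ) (hY.pow_const 2) (a ^ 2)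
  have h2 : σ {x | a < Y x} ≤ σ {x | a ^ 2 ≤ Y x ^ 2} :=
    measure_mono fun x (hx : a < Y x) => show a ^ 2 ≤ Y x ^ 2 from pow_le_pow_left' hx.le 2
  have h3 : a ^ 2 * σ {x | a < Y x} ≤ a ^ 2 * a :=
    ((mul_le_mul_right h2 _).trans h1).trans (h.trans_eq (by ring))
  exact (ENNReal.mul_le_mul_iff_right (pow_ne_zero 2 h0) (ENNReal.pow_ne_top htop)).1 h3

/-- The union bound over the first `⌊p / a⌋` of a sequence of events of probability at most `a`,
with `p / 0 = ∞` and `p / ∞ = 0`. -/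
theorem exists_measurableSet_avoiding {X : Type*} [MeasurableSpace X] {σ : Measure X}
    [IsProbabilityMeasure σ] {bad : ℕ → Set X} (hm : ∀ t, MeasurableSet (bad t)) {a : ℝ≥0∞}
    (hbad : ∀ t, σ (bad t) ≤ a) {p : ℝ} (hp : 0 < p) :
    ∃ S : Set X, MeasurableSet S ∧ ENNReal.ofReal (1 - p) ≤ σ S ∧
      ∀ t : ℕ, ((t + 1 : ℕ) : ℝ≥0∞) ≤ ENNReal.ofReal p / a → ∀ x ∈ S, x ∉ bad t := by
  let I : Set ℕ := {t | ((t + 1 : ℕ) : ℝ≥0∞) ≤ ENNReal.ofReal p / a}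
  have hU : MeasurableSet (⋃ t ∈ I, bad t) :=
    MeasurableSet.biUnion (to_countable I) fun t _ => hm t
  have hσ : σ (⋃ t ∈ I, bad t) ≤ ENNReal.ofReal p := by
    rcases eq_or_ne a 0 with rfl | h0
    · refine (measure_biUnion_null_iff (to_countable I)).2 (fun t _ => ?_) |>.trans_le zero_le
      exact nonpos_iff_eq_zero.1 (hbad t)
    have hfin : ENNReal.ofReal p / a ≠ ∞ := ENNReal.div_ne_top ENNReal.ofReal_ne_top h0
    set N := ⌊(ENNReal.ofReal p / a).toReal⌋₊ with hN
    have hNle : (N : ℝ≥0∞) ≤ ENNReal.ofReal p / a := by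
      rw [← ENNReal.ofReal_toReal hfin, ← ENNReal.ofReal_natCast]
      exact ENNReal.ofReal_le_ofReal (Nat.floor_le ENNReal.toReal_nonneg)
    have hsub : (⋃ t ∈ I, bad t) ⊆ ⋃ t ∈ Finset.range N, bad t := by
      refine biUnion_subset_biUnion_left fun t ht => ?_
      have : ((t + 1 : ℕ) : ℝ) ≤ (ENNReal.ofReal p / a).toReal := by
        rw [← ENNReal.toReal_natCast]
        exact ENNReal.toReal_mono hfin ht
      exact Finset.mem_coe.2 (Finset.mem_range.2 (Nat.le_floor this))
    calc σ (⋃ t ∈ I, bad t) ≤ ∑ t ∈ Finset.range N, σ (bad t) :=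
          (measure_mono hsub).trans (measure_biUnion_finset_le _ _)
      _ ≤ N * a := by
          refine (Finset.sum_le_card_nsmul _ _ a fun t _ => hbad t).trans_eq ?_
          rw [Finset.card_range, nsmul_eq_mul]
      _ ≤ ENNReal.ofReal p := ENNReal.mul_le_of_le_div hNle
  refine ⟨(⋃ t ∈ I, bad t)ᶜ, hU.compl, ?_, fun t ht x hx hxb => hx (mem_biUnion ht hxb)⟩
  rw [prob_compl_eq_one_sub hU, ENNReal.ofReal_sub _ hp.le, ENNReal.ofReal_one]
  exact tsub_le_tsub_left hσ 1

/-- Two oracles that agree on the queries made against one of them give the same responses. -/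
theorem IterativeAlgorithm.responses_congr {k : ℕ} {W : Set (EuclideanSpace ℝ (Fin k))}
    {Ω Out : Type} (A : IterativeAlgorithm W Ω Out)
    {O m : EuclideanSpace ℝ (Fin k) → EuclideanSpace ℝ (Fin k)} (ω : Ω) (T : ℕ)
    (h : ∀ t < T, O (A.query ω (A.responses m ω t)) = m (A.query ω (A.responses m ω t))) :
    A.responses O ω T = A.responses m ω T := by
  induction T with
  | zero => rfl
  | succ T ih =>
    have hT := ih fun t ht => h t (ht.trans (Nat.lt_succ_self T))
    simp only [IterativeAlgorithm.responses]
    rw [hT, h T (Nat.lt_succ_self T)]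

theorem accuracy_pow_three {k : ℕ} (c₂ c₃ : ℝ) (d : ℕ) (r : ℝ) (ε : ℝ → ℝ)
    (W : Set (EuclideanSpace ℝ (Fin k))) (G : EuclideanSpace ℝ (Fin k) → ℝ≥0) :
    accuracy c₂ c₃ d r ε W G ^ 3 = ENNReal.ofReal c₂ * (⨆ w ∈ W, (G w : ℝ≥0∞)) *
      (ENNReal.ofReal (Real.exp (-c₃ * d)) +
        ∑' n : ℕ, ENNReal.ofReal (ε (((n : ℝ) + 1) * r))) := by
  rw [accuracy, ← ENNReal.rpow_natCast, ← ENNReal.rpow_mul]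
  norm_num

theorem LocallyBoundedVariationOn.measurable {ψ : ℝ → ℝ}
    (h : LocallyBoundedVariationOn ψ univ) : Measurable ψ := by
  obtain ⟨p, q, hp, hq, rfl⟩ := h.exists_monotoneOn_sub_monotoneOn
  exact (monotoneOn_univ.1 hp).measurable.sub (monotoneOn_univ.1 hq).measurable

/-- Replacing the target by its mean changes the gradient by twice the correlation. -/
theorem enorm_sub_gradient_objective {d k : ℕ} {μ : Measure (EuclideanSpace ℝ (Fin d))}
    [IsFiniteMeasure μ] {ψ : ℝ → ℝ} (hψ : Measurable ψ) (hb : ∀ t, ψ t ∈ Icc (-1 : ℝ) 1)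
    {f : EuclideanSpace ℝ (Fin k) → EuclideanSpace ℝ (Fin d) → ℝ}
    {g : EuclideanSpace ℝ (Fin d) → EuclideanSpace ℝ (Fin k)}
    {wstar : EuclideanSpace ℝ (Fin d)} {w : EuclideanSpace ℝ (Fin k)}
    (hgrad : HasGradientAt (objective μ ψ f wstar)
      ((2 : ℝ) • ∫ x, (f w x - ψ ⟪wstar, x⟫) • g x ∂μ) w)
    (hf : MemLp (f w) 2 μ) (hg : MemLp g 2 μ) :
    ‖(2 : ℝ) • (∫ x, (f w x - ∫ t in (0 : ℝ)..1, ψ t) • g x ∂μ) -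
      gradient (objective μ ψ f wstar) w‖ₑ = 2 * ‖correlation μ ψ g wstar‖ₑ := by
  have hf' : MemLp (fun x => f w x - ∫ t in (0 : ℝ)..1, ψ t) 2 μ := hf.sub (memLp_const _)
  have hi1 : Integrable (fun x => (f w x - ∫ t in (0 : ℝ)..1, ψ t) • g x) μ :=
    memLp_one_iff_integrable.1 (hg.smul hf')
  have hi2 := integrable_sub_mean_smul hψ hb (hg.integrable one_le_two) wstar
  have heq : ∫ x, (f w x - ψ ⟪wstar, x⟫) • g x ∂μ =
      (∫ x, (f w x - ∫ t in (0 : ℝ)..1, ψ t) • g x ∂μ) - correlation μ ψ g wstar := by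
    rw [correlation, ← integral_sub hi1 hi2]
    refine integral_congr_ae (.of_forall fun x => ?_)
    simp only [← sub_smul]
    congr 1
    ring
  rw [hgrad.gradient, heq, smul_sub, sub_sub_cancel, enorm_smul]
  congr 1
  rw [Real.enorm_of_nonneg zero_le_two]
  simp

end Oracle

theorem theorem4 :
    ∃ c₁ c₂ c₃ : ℝ, 0 < c₁ ∧ 0 < c₂ ∧ 0 < c₃ ∧
    ∀ (d : ℕ), c₁ ≤ (d : ℝ) → ∀ (r : ℝ), 0 ≤ r →
    -- the target function
    ∀ (ψ : ℝ → ℝ), (∀ t, ψ t ∈ Icc (-1 : ℝ) 1) → Function.Periodic ψ 1 →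
      LocallyBoundedVariationOn ψ univ →
    -- the input distribution
    ∀ (ε : ℝ → ℝ), (∀ s, 0 ≤ s → ε s ∈ Icc (0 : ℝ) 1) →
    ∀ (ι : Type) [Countable ι] (α : ι → ℝ) (φ : ι → EuclideanSpace ℝ (Fin d) → ℝ),
      (∀ i, 0 ≤ α i) → HasSum α 1 →
      (∀ i, ∫ x, φ i x ^ 2 = 1) → (∀ i, IsFourierConcentrated ε (φ i)) →
    -- the predictors
    ∀ (k : ℕ) (W : Set (EuclideanSpace ℝ (Fin k)))
      (f : EuclideanSpace ℝ (Fin k) → EuclideanSpace ℝ (Fin d) → ℝ)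
      (G : EuclideanSpace ℝ (Fin k) → ℝ≥0),
      (∀ w ∈ W, ∀ᶠ v in 𝓝 w, MemLp (f v) 2 (mixtureMeasure α φ)) →
      (∀ w ∈ W, ∀ᵐ x ∂(mixtureMeasure α φ), DifferentiableAt ℝ (fun v => f v x) w) →
      (∀ w ∈ W, ∃ K : ℝ≥0, ∀ᶠ v in 𝓝 w,
        eLpNorm (fun x => f v x - f w x) 2 (mixtureMeasure α φ) ≤ K * ‖v - w‖ₑ) →
      (∀ w ∈ W, ∫⁻ x, ‖gradient (fun v => f v x) w‖ₑ ^ 2 ∂(mixtureMeasure α φ) ≤ G w) →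
    -- there is an approximate gradient oracle ...
    ∃ oracle : EuclideanSpace ℝ (Fin d) → EuclideanSpace ℝ (Fin k) → EuclideanSpace ℝ (Fin k),
      (∀ wstar, ‖wstar‖ = 2 * r → ∀ w ∈ W,
        DifferentiableAt ℝ (objective (mixtureMeasure α φ) ψ f wstar) w ∧
        ‖oracle wstar w - gradient (objective (mixtureMeasure α φ) ψ f wstar) w‖ₑ
          ≤ accuracy c₂ c₃ d r ε W G) ∧
      -- ... with which no algorithm learns anything about `wstar`
      ∀ (Ω Out : Type) (A : IterativeAlgorithm W Ω Out) (p : ℝ), p ∈ Ioo (0 : ℝ) 1 →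
      ∀ ω : Ω, ∃ S : Set (EuclideanSpace ℝ (Fin d)), MeasurableSet S ∧
        ENNReal.ofReal (1 - p) ≤ sphereUniform d (2 * r) S ∧
        ∀ T : ℕ, (T : ℝ≥0∞) ≤ ENNReal.ofReal p / accuracy c₂ c₃ d r ε W G →
          ∃ o : Out, ∀ wstar ∈ S, A.outputAfter (oracle wstar) ω T = o := by
  refine ⟨1, 256, Real.log 3 / 2, one_pos, by norm_num, by positivity, ?_⟩
  intro d hd1 r hr ψ hb hper hBV ε _ ι _ α φ hα hα1 h1 hφ k W f G hmem hdiff hLip hG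
  have hd : 0 < d := by exact_mod_cast zero_lt_one.trans_le hd1
  have hψ : Measurable ψ := hBV.measurable
  have hP := isProbabilityMeasure_mixtureMeasure hα hα1 h1 hφ
  have hσ := isProbabilityMeasure_sphereUniform hd (2 * r)
  set μ := mixtureMeasure α φ with hμ
  set acc := accuracy 256 (Real.log 3 / 2) d r ε W G with hacc
  let g : EuclideanSpace ℝ (Fin k) → EuclideanSpace ℝ (Fin d) → EuclideanSpace ℝ (Fin k) :=
    fun w x => gradient (fun v => f v x) w
  have hg (w) (hw : w ∈ W) : MemLp (g w) 2 μ := memLp_gradient (hmem w hw) (hdiff w hw) (hG w hw)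
  let a₀ : ℝ := ∫ t in (0 : ℝ)..1, ψ t
  -- the gradient with `ψ` replaced by its mean does not depend on `wstar`
  let m : EuclideanSpace ℝ (Fin k) → EuclideanSpace ℝ (Fin k) :=
    fun w => (2 : ℝ) • ∫ x, (f w x - a₀) • g w x ∂μ
  have hgrad (wstar) (w) (hw : w ∈ W) : HasGradientAt (objective μ ψ f wstar)
      ((2 : ℝ) • ∫ x, (f w x - ψ ⟪wstar, x⟫) • g w x ∂μ) w := by
    refine hasGradientAt_integral_sub_sq ?_ (hmem w hw)
      ((hdiff w hw).mono fun x hx => hx.hasGradientAt) (hLip w hw) (hg w hw)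
    exact MemLp.of_bound (hψ.comp (by fun_prop)).aestronglyMeasurable 1
      (.of_forall fun x => abs_le.2 (hb _))
  have hdist (wstar) (w) (hw : w ∈ W) :
      ‖m w - gradient (objective μ ψ f wstar) w‖ₑ = 2 * ‖correlation μ ψ (g w) wstar‖ₑ := by
    exact enorm_sub_gradient_objective hψ hb (hgrad wstar w hw) (hmem w hw).self_of_nhds (hg w hw)
  have hvar (w) (hw : w ∈ W) :
      ∫⁻ wstar, (2 * ‖correlation μ ψ (g w) wstar‖ₑ) ^ 2 ∂sphereUniform d (2 * r) ≤ acc ^ 3 := by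
    simp_rw [mul_pow]
    rw [lintegral_const_mul' _ _ (by simp), hacc, accuracy_pow_three]
    refine (mul_le_mul_right
      (lintegral_enorm_correlation_sq_le hd hr hψ hb hper hα hα1 h1 hφ (hg w hw)) _).trans ?_
    rw [← mul_assoc, ← mul_assoc]
    gcongr
    · norm_num
    · exact (hG w hw).trans (le_iSup₂ (f := fun w (_ : w ∈ W) => (G w : ℝ≥0∞)) w hw)
  classical
  refine ⟨fun wstar w => if ‖m w - gradient (objective μ ψ f wstar) w‖ₑ ≤ acc then m w
    else gradient (objective μ ψ f wstar) w, fun wstar _ w hw =>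
      ⟨(hgrad wstar w hw).differentiableAt, ?_⟩, fun Ω Out A p hp ω => ?_⟩
  · dsimp only
    split_ifs with h
    · exact h
    · simp
  -- the queries made when every response is the one that does not depend on `wstar`
  let q : ℕ → W := fun t => A.query ω (A.responses m ω t)
  obtain ⟨S, hSm, hSp, hS⟩ := exists_measurableSet_avoiding (σ := sphereUniform d (2 * r))
    (bad := fun t => {wstar | acc < 2 * ‖correlation μ ψ (g (q t)) wstar‖ₑ}) (a := acc)
    (fun t => measurableSet_lt measurable_const
      ((measurable_correlation hψ (hg _ (q t).2).1).enorm.const_mul 2))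
    (fun t => measure_lt_le_of_lintegral_sq_le_cube
      ((measurable_correlation hψ (hg _ (q t).2).1).enorm.const_mul 2) (hvar _ (q t).2)) hp.1
  refine ⟨S, hSm, hSp, fun T hT => ⟨A.output ω (A.responses m ω T), fun wstar hw => ?_⟩⟩
  rw [IterativeAlgorithm.outputAfter, A.responses_congr ω T fun t ht => ?_]
  refine if_pos ?_
  rw [hdist wstar _ (q t).2]
  exact not_lt.1 (hS t (le_trans (by exact_mod_cast ht) hT) wstar hw)
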